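/- Let $T\in(0,\infty)$ and let $(\Omega,\mathbb F=(\mathcal F_t)_{t\in[0,T]},P)$ be a filtered probability space satisfying the usual conditions (right-continuous, $\mathcal F_0$ contains all subsets of $P$-null sets), with $\mathcal F_0$ containing only events of probability $0$ or $1$. A stopping time $\tau$ with values in $[0,T]$ is predictable if it is foretold by a sequence of stopping times $(\tau_n)$, i.e. a.s. $\tau_n$ is nondecreasing, $\tau_n\to\tau$, and $\tau_n<\tau$ for all $n$ on $\{\tau>0\}$. Let $\mathcal T_0^p$ be the set of predictable stopping times. For $S\in\mathcal T^p_0$ let $\mathcal F_{S^-}$ be the $\sigma$-algebra generated by $\mathcal F_0$ and the sets $A\cap\{t<S\}$, $t\in[0,T]$, $A\in\mathcal F_t$; let $\mathcal T_S^p=\{\tau\in\mathcal T_0^p:\tau\ge S\text{ a.s.}\}$ and $\mathcal T_{S^+}^p=\{\tau\in\mathcal T_0^p:\tau>S\text{ a.s. on }\{S<T\},\ \tau=T\text{ a.s. on }\{S=T\}\}$. Let $(\phi(\tau),\tau\in\mathcal T_0^p)$ be a uniformly integrable admissible family: each $\phi(\tau)$ is an $\mathcal F_{\tau^-}$-measurable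 $[0,\infty]$-valued random variable, $\phi(\tau)=\phi(\tau')$ a.s. on $\{\tau=\tau'\}$ for all $\tau,\tau'\in\mathcal T_0^p$, and the family is uniformly integrable. Put, for $S\in\mathcal T_0^p$, $$V_p(S)=\operatorname*{ess\,sup}_{\tau\in\mathcal T_S^p}E[\phi(\tau)\mid\mathcal F_{S^-}],\qquad V_p^+(S)=\operatorname*{ess\,sup}_{\tau\in\mathcal T_{S^+}^p}E[\phi(\tau)\mid\mathcal F_{S^-}].$$ Then for every $S\in\mathcal T_0^p$ the family $V_p$ has a right limit and a left limit at $S$: there is an $\mathcal F_S$-measurable $V_p(S^+)$ such that $V_p(S_n)\to V_p(S^+)$ a.s. for every sequence $(S_n)$ in $\mathcal T_{S^+}^p$ with $S_n\downarrow S$ a.s., and an $\mathcal F_{S^-}$-measurable $V_p(S^-)$ such that $V_p(S_n)\to V_p(S^-)$ a.s. for every sequence $(S_n)$ of predictable stopping times foretelling $S$. Moreover, for every $S\in\mathcal T_0^p$ the following hold a.s.: 1. $E[V_p(\tau)\mid\mathcal F_{S^-}]\le E[V_p(S^+)\mid\mathcal F_{S^-}]$ for every $\tau\in\mathcal T_0^p$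 with $\tau>S$ a.s.; 2. $V_p^+(S)\le E[V_p(S^+)\mid\mathcal F_{S^-}]$; 3. $V_p(S)\le V_p(S^-)$; 4. $E[V_p(S^+)\mid\mathcal F_{S^-}]\le V_p(S)$; 5. $V_p(S)=\phi(S)\vee E[V_p(S^+)\mid\mathcal F_{S^-}]$; 6. $V_p(S)$ and $E[V_p(S^+)\mid\mathcal F_{S^-}]$ are finite, and $V_p(S)-E[V_p(S^+)\mid\mathcal F_{S^-}]=\bigl(V_p(S)-E[V_p(S^+)\mid\mathcal F_{S^-}]\bigr)\mathbf 1_{\{V_p(S)=\phi(S)\}}$. Finally, if $V_p$ is right continuous along predictable stopping times in expectation (RCPE), i.e. $E[V_p(\theta)]=\lim_n E[V_p(\theta_n)]$ for all $\theta,\theta_n\in\mathcal T_0^p$ with $\theta_n\downarrow\theta$ a.s., then $E[V_p(S^+)\mid\mathcal F_{S^-}]=V_p(S)$ a.s. for every $S\in\mathcal T_0^p$. -/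

import Mathlib

open MeasureTheory Filter Topology
open scoped ENNReal NNReal

namespace PredictableStopping

noncomputable section

/-- The time set `[0, T]`; its least element `⊥` is the time `0`, its greatest element `⊤` is `T`. -/
abbrev TimeSet (T : ℝ≥0) : Type := Set.Iic T

variable {Ω : Type*} {m0 : MeasurableSpace Ω} {T : ℝ≥0}

/-- The usual assumptions: right continuity, and every subset of a `P`-null set lies in `𝓕 0`. -/
structure UsualConditions (𝓕 : Filtration (TimeSet T) m0) (P : Measure Ω) : Prop where
  rightContinuous : 𝓕.IsRightContinuous
  complete : ∀ A : Set Ω, P A = 0 → MeasurableSet[𝓕 ⊥] A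

/-- A `[0, T]`-valued stopping time. -/
def IsStopping (𝓕 : Filtration (TimeSet T) m0) (τ : Ω → TimeSet T) : Prop :=
  IsStoppingTime 𝓕 (fun ω => ((τ ω : TimeSet T) : WithTop (TimeSet T)))

/-- The sequence `σ` foretells `τ`: almost surely it is nondecreasing with limit `τ`, and
`σ n < τ` for all `n` on the event `{0 < τ}`. -/
def Foretells (P : Measure Ω) (σ : ℕ → Ω → TimeSet T) (τ : Ω → TimeSet T) : Prop :=
  ∀ᵐ ω ∂P, Monotone (fun n => σ n ω) ∧ Tendsto (fun n => σ n ω) atTop (𝓝 (τ ω)) ∧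
    (⊥ < τ ω → ∀ n, σ n ω < τ ω)

/-- The class of predictable stopping times with values in `[0, T]`. -/
structure PredictableTime (𝓕 : Filtration (TimeSet T) m0) (P : Measure Ω) where
  /-- the underlying random time -/
  time : Ω → TimeSet T
  isStopping : IsStopping 𝓕 time
  foretold : ∃ σ : ℕ → Ω → TimeSet T, (∀ n, IsStopping 𝓕 (σ n)) ∧ Foretells P σ time

variable {𝓕 : Filtration (TimeSet T) m0} {P : Measure Ω}

namespace PredictableTime

/-- The σ-algebra `𝓕_{τ-}` of events strictly prior to `τ`, generated by `𝓕 0` and the sets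
`A ∩ {t < τ}` with `A ∈ 𝓕 t`. -/
@[reducible] def past (τ : PredictableTime 𝓕 P) : MeasurableSpace Ω :=
  MeasurableSpace.generateFrom
    ({A | MeasurableSet[𝓕 ⊥] A} ∪
      {B | ∃ (t : TimeSet T) (A : Set Ω), MeasurableSet[𝓕 t] A ∧ B = A ∩ {ω | t < τ.time ω}})

/-- The σ-algebra `𝓕_τ`. -/
@[reducible] def sigma (τ : PredictableTime 𝓕 P) : MeasurableSpace Ω :=
  IsStoppingTime.measurableSpace τ.isStopping

theorem past_le (τ : PredictableTime 𝓕 P) : τ.past ≤ m0 := by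
  refine MeasurableSpace.generateFrom_le ?_
  rintro B (hB | ⟨t, A, hA, rfl⟩)
  · exact 𝓕.le _ _ hB
  · refine 𝓕.le t _ (hA.inter ?_)
    have h := (τ.isStopping t).compl
    have e : {ω | t < τ.time ω} =
        {ω | ((τ.time ω : TimeSet T) : WithTop (TimeSet T)) ≤ (t : WithTop (TimeSet T))}ᶜ := by
      ext ω
      simp
    rw [e]
    exact h

end PredictableTime

/-- `τ ∈ 𝒯_S^p`. -/
def After (S τ : PredictableTime 𝓕 P) : Prop :=
  ∀ᵐ ω ∂P, S.time ω ≤ τ.time ω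

/-- `τ ∈ 𝒯_{S+}^p`: almost surely, `τ > S` on `{S < T}` and `τ = T` on `{S = T}`. -/
def StrictlyAfter (S τ : PredictableTime 𝓕 P) : Prop :=
  ∀ᵐ ω ∂P, (S.time ω < ⊤ → S.time ω < τ.time ω) ∧ (S.time ω = ⊤ → τ.time ω = ⊤)

/-- A family of `[0, ∞]`-valued functions on `Ω` indexed by the predictable stopping times. -/
abbrev Family (𝓕 : Filtration (TimeSet T) m0) (P : Measure Ω) :=
  PredictableTime 𝓕 P → Ω → ℝ≥0∞

/-- Predictable admissible families. -/
structure IsAdmissible (φ : Family 𝓕 P) : Prop where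
  measurable : ∀ τ : PredictableTime 𝓕 P, Measurable[τ.past] (φ τ)
  congr : ∀ τ τ' : PredictableTime 𝓕 P, ∀ᵐ ω ∂P, τ.time ω = τ'.time ω → φ τ ω = φ τ' ω

/-- Uniform integrability of a family of `[0, ∞]`-valued random variables. -/
def IsUniformlyIntegrable (φ : Family 𝓕 P) : Prop :=
  (∀ τ, ∀ᵐ ω ∂P, φ τ ω ≠ ∞) ∧ UniformIntegrable (fun τ ω => (φ τ ω).toReal) 1 P

/-- `g` is an `m`-measurable version of the essential supremum of the family `f`. -/
structure IsEssSup {ι : Type*} (m : MeasurableSpace Ω) (P : Measure[m0] Ω)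
    (f : ι → Ω → ℝ≥0∞) (g : Ω → ℝ≥0∞) : Prop where
  measurable : Measurable[m] g
  le : ∀ i, f i ≤ᵐ[P] g
  least : ∀ h : Ω → ℝ≥0∞, Measurable[m0] h → (∀ i, f i ≤ᵐ[P] h) → g ≤ᵐ[P] h

theorem exists_isEssSup {ι : Type*} {m : MeasurableSpace Ω} (hm : m ≤ m0)
    (P : Measure[m0] Ω) [IsFiniteMeasure P] (f : ι → Ω → ℝ≥0∞)
    (hf : ∀ i, Measurable[m] (f i)) : ∃ g, IsEssSup m P f g := by
  classical
  let G : Set ι → Ω → ℝ≥0∞ := fun c ω => ⨆ i ∈ c, f i ω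
  let J : Set ι → ℝ≥0∞ := fun c => ∫⁻ ω, (1 + G c ω)⁻¹ ∂P
  have hGm : ∀ c : Set ι, c.Countable → Measurable[m] (G c) := fun c hc =>
    Measurable.biSup c hc (fun i _ => hf i)
  have hGmono : ∀ c d : Set ι, c ⊆ d → ∀ ω, G c ω ≤ G d ω := fun c d hcd ω =>
    biSup_mono (fun i hi => hcd hi)
  have hJanti : ∀ c d : Set ι, c ⊆ d → J d ≤ J c := fun c d hcd =>
    lintegral_mono fun ω => ENNReal.inv_le_inv.2 (add_le_add le_rfl (hGmono c d hcd ω))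
  let V : Set ℝ≥0∞ := J '' {c | c.Countable}
  have hVne : V.Nonempty := ⟨J ∅, ∅, Set.countable_empty, rfl⟩
  obtain ⟨u, -, hu, huV⟩ := exists_seq_tendsto_sInf hVne (OrderBot.bddBelow V)
  choose c hc hcu using huV
  let C : Set ι := ⋃ n, c n
  have hC : C.Countable := Set.countable_iUnion hc
  have hJC : ∀ d : Set ι, d.Countable → J C ≤ J d := by
    intro d hd
    have h1 : J C ≤ sInf V := ge_of_tendsto' hu fun n => by
      rw [← hcu n]
      exact hJanti _ _ (Set.subset_iUnion c n)
    exact h1.trans (sInf_le ⟨d, hd, rfl⟩)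
  refine ⟨G C, hGm C hC, fun i => ?_, fun h _ hle => ?_⟩
  · have hd : (insert i C).Countable := hC.insert i
    have hmeas : ∀ d : Set ι, d.Countable → Measurable[m0] fun ω => (1 + G d ω)⁻¹ := fun d hd =>
      (measurable_const.add ((hGm d hd).mono hm le_rfl)).inv
    have hfin : J (insert i C) ≠ ∞ := by
      have hb : J (insert i C) ≤ ∫⁻ _, 1 ∂P := lintegral_mono fun ω => by
        simp
      refine ne_top_of_le_ne_top ?_ hb
      simp
    have hpt : (fun ω => (1 + G (insert i C) ω)⁻¹) ≤ᵐ[P] fun ω => (1 + G C ω)⁻¹ :=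
      Eventually.of_forall fun ω =>
        ENNReal.inv_le_inv.2 (add_le_add le_rfl (hGmono _ _ (Set.subset_insert i C) ω))
    have heq := ae_eq_of_ae_le_of_lintegral_le hpt hfin (hmeas C hC).aemeasurable
      (hJC _ hd)
    filter_upwards [heq] with ω hω
    have h2 : 1 + G (insert i C) ω = 1 + G C ω := inv_injective hω
    have h3 : G (insert i C) ω = G C ω := (ENNReal.add_right_inj ENNReal.one_ne_top).1 h2
    rw [← h3]
    exact le_biSup (fun j => f j ω) (Set.mem_insert i C)
  · have hall : ∀ᵐ ω ∂P, ∀ i ∈ C, f i ω ≤ h ω := (ae_ball_iff hC).2 fun i _ => hle i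
    filter_upwards [hall] with ω hω
    exact iSup₂_le hω

/-- The essential supremum, with respect to `P`, of a family of `m`-measurable functions. -/
def essSupFamily {ι : Type*} {m : MeasurableSpace Ω} (hm : m ≤ m0)
    (P : Measure[m0] Ω) [IsFiniteMeasure P] (f : ι → Ω → ℝ≥0∞)
    (hf : ∀ i, Measurable[m] (f i)) : Ω → ℝ≥0∞ :=
  Classical.choose (exists_isEssSup hm P f hf)

theorem essSupFamily_spec {ι : Type*} {m : MeasurableSpace Ω} (hm : m ≤ m0)
    (P : Measure[m0] Ω) [IsFiniteMeasure P] (f : ι → Ω → ℝ≥0∞)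
    (hf : ∀ i, Measurable[m] (f i)) : IsEssSup m P f (essSupFamily hm P f hf) :=
  Classical.choose_spec (exists_isEssSup hm P f hf)

/-- The conditional expectation `E[X | 𝓕_{S-}]` of a `[0, ∞]`-valued random variable. -/
def condPast (S : PredictableTime 𝓕 P) (X : Ω → ℝ≥0∞) : Ω → ℝ≥0∞ :=
  condLExp S.past P X

/-- The value family `V_p(S) = ess sup_{τ ∈ 𝒯_S^p} E[φ(τ) | 𝓕_{S-}]`. -/
def value [IsFiniteMeasure P] (φ : Family 𝓕 P) : Family 𝓕 P := fun S =>
  essSupFamily S.past_le P (fun τ : {τ : PredictableTime 𝓕 P // After S τ} => condPast S (φ τ))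
    (fun τ => measurable_condLExp S.past P (φ τ))

/-- The strict value family `V_p^+(S) = ess sup_{τ ∈ 𝒯_{S+}^p} E[φ(τ) | 𝓕_{S-}]`. -/
def strictValue [IsFiniteMeasure P] (φ : Family 𝓕 P) : Family 𝓕 P := fun S =>
  essSupFamily S.past_le P
    (fun τ : {τ : PredictableTime 𝓕 P // StrictlyAfter S τ} => condPast S (φ τ))
    (fun τ => measurable_condLExp S.past P (φ τ))

/-- `s n ↓ S` almost surely. -/
def DecreasesTo (s : ℕ → PredictableTime 𝓕 P) (S : PredictableTime 𝓕 P) : Prop :=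
  ∀ᵐ ω ∂P, Antitone (fun n => (s n).time ω) ∧
    Tendsto (fun n => (s n).time ω) atTop (𝓝 (S.time ω))

/-- `R` is (a version of) the right limit `U(S+)`: it is `𝓕_S`-measurable, and `U(S_n) → R` a.s.
whenever the `S_n ∈ 𝒯_{S+}^p` decrease to `S`. -/
def IsRightLimit (U : Family 𝓕 P) (S : PredictableTime 𝓕 P) (R : Ω → ℝ≥0∞) : Prop :=
  Measurable[S.sigma] R ∧
    ∀ s : ℕ → PredictableTime 𝓕 P, (∀ n, StrictlyAfter S (s n)) → DecreasesTo s S →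
      ∀ᵐ ω ∂P, Tendsto (fun n => U (s n) ω) atTop (𝓝 (R ω))

/-- `L` is (a version of) the left limit `U(S-)`: it is `𝓕_{S-}`-measurable, and `U(S_n) → L` a.s.
whenever the predictable times `S_n` foretell `S`. -/
def IsLeftLimit (U : Family 𝓕 P) (S : PredictableTime 𝓕 P) (L : Ω → ℝ≥0∞) : Prop :=
  Measurable[S.past] L ∧
    ∀ s : ℕ → PredictableTime 𝓕 P, Foretells P (fun n => (s n).time) S.time →
      ∀ᵐ ω ∂P, Tendsto (fun n => U (s n) ω) atTop (𝓝 (L ω))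

/-- Right continuity along predictable stopping times in expectation. -/
def RCPE (U : Family 𝓕 P) : Prop :=
  ∀ (θ : PredictableTime 𝓕 P) (s : ℕ → PredictableTime 𝓕 P), DecreasesTo s θ →
    Tendsto (fun n => ∫⁻ ω, U (s n) ω ∂P) atTop (𝓝 (∫⁻ ω, U θ ω ∂P))

end

end PredictableStopping

/-!
# Right and left limits of the value family of predictable optimal stopping

Everything about the value family `V` is expressed through the integrals `∫_A V(S)` over events `A`
strictly prior to `S`, with values in `[0, ∞]`. Three facts about `V` carry the theorem.

* The conditional expected rewards `E[φ(τ) | 𝓕_{S-}]`, `τ ≥ S`, form an upward directed family, so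
  `V(S)` is the limit of an increasing sequence of them (`IsEssSup.exists_seq`). Directedness is
  the pasting of two predictable times along an event strictly prior to `S`
  (`UsualConditions.exists_predictableTime_paste`); the pasted time is predictable by Lévy's upward
  theorem along a sequence foretelling `S`.
* Hence `V` is a supermartingale system, `∫_A V(τ) ≤ ∫_A V(S)` for `τ ≥ S` and `A ∈ 𝓕_{S-}`
  (`IsAdmissible.setLIntegral_value_le`), it is uniformly integrable
  (`IsAdmissible.uniformTail_value`), and it is admissible (`IsAdmissible.value_congr`).
* Doob's upcrossing inequality then makes `V(sₙ)` converge almost surely along monotone sequences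
  of predictable times. For decreasing sequences the inequality is applied to the time-reversed
  finite segments, whose numbers of upcrossings are bounded in mean uniformly in their length.

Limits along different sequences are compared by mixing the sequences: `sₙ ∧ s'ₘ` on the right and
`sₙ ∨ s'ₘ` on the left, which for fixed `n` eventually agree with `s'ₘ`. On the right this gives
`∫_A V(τ) ≤ ∫_A V(S+)` for all `τ` strictly after `S`
(`IsAdmissible.setLIntegral_value_le_of_tendsto`), the source of both uniqueness and the
inequalities for `E[V(S+) | 𝓕_{S-}]`; on the left, Lévy's theorem finishes the comparison and also
yields `V(S) ≤ V(S-)`. That left limits are not vacuous requires a foretelling sequence made of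
*predictable* times, which `UsualConditions.exists_foretells` constructs.

The identity `V(S) = φ(S) ∨ E[V(S+) | 𝓕_{S-}]` rests on `{τ = S} ∈ 𝓕_{S-}` for predictable `τ`: on
that event `τ` earns `φ(S)`, and off it `τ` may be replaced by a time strictly after `S`
(`IsAdmissible.value_le_max`).
-/

namespace PredictableStopping

/-! ### Uniformly small tails -/

section Generic

variable {Ω : Type*} {m0 : MeasurableSpace Ω} {P : Measure Ω}

/-- Uniform integrability of a family of `[0, ∞]`-valued functions, expressed through the excess
over a constant: `∫ (X i - C)⁺` is uniformly small for large `C`. -/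
def UniformTail {ι : Type*} (P : Measure Ω) (X : ι → Ω → ℝ≥0∞) : Prop :=
  ∀ ε : ℝ≥0∞, ε ≠ 0 → ∃ C : ℝ≥0, ∀ i, ∫⁻ ω, (X i ω - C) ∂P ≤ ε

theorem UniformTail.comp {ι κ : Type*} {X : ι → Ω → ℝ≥0∞} (h : UniformTail P X) (u : κ → ι) :
    UniformTail P (fun k => X (u k)) := fun ε hε => by
  obtain ⟨C, hC⟩ := h ε hε
  exact ⟨C, fun k => hC _⟩

theorem uniformTail_of_uniformIntegrable {ι : Type*} {X : ι → Ω → ℝ≥0∞}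
    (hfin : ∀ i, ∀ᵐ ω ∂P, X i ω ≠ ∞)
    (h : UniformIntegrable (fun i ω => (X i ω).toReal) 1 P) : UniformTail P X := by
  intro ε hε
  obtain ⟨δ, hδ, hδε⟩ : ∃ δ : ℝ, 0 < δ ∧ ENNReal.ofReal δ ≤ ε := by
    rcases eq_or_ne ε ∞ with rfl | hε'
    · exact ⟨1, one_pos, le_top⟩
    · exact ⟨ε.toReal, ENNReal.toReal_pos hε hε', by rw [ENNReal.ofReal_toReal hε']⟩
  obtain ⟨C, hC⟩ := h.spec one_ne_zero ENNReal.one_ne_top hδ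
  refine ⟨C, fun i => le_trans ?_ ((hC i).trans hδε)⟩
  rw [eLpNorm_one_eq_lintegral_enorm]
  refine lintegral_mono_ae ((hfin i).mono fun ω hω => ?_)
  rcases le_total (X i ω) C with hc | hc
  · rw [tsub_eq_zero_of_le hc]
    exact zero_le
  · rw [Set.indicator_of_mem]
    · rw [Real.enorm_eq_ofReal ENNReal.toReal_nonneg, ENNReal.ofReal_toReal hω]
      exact tsub_le_self
    · simp only [Set.mem_ofPred_eq]
      rw [← ENNReal.coe_le_coe, ← enorm_eq_nnnorm, Real.enorm_eq_ofReal ENNReal.toReal_nonneg,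
        ENNReal.ofReal_toReal hω]
      exact hc

/-! ### Essential suprema of directed families -/

/-- The essential supremum of a family that is upward directed and bounded in mean is the
pointwise supremum of an increasing sequence of its members. -/
theorem IsEssSup.exists_seq {ι : Type*} [Nonempty ι] {m : MeasurableSpace Ω} (hm : m ≤ m0)
    {f : ι → Ω → ℝ≥0∞} {g : Ω → ℝ≥0∞} (hg : IsEssSup m P f g) (hf : ∀ i, Measurable[m] (f i))
    (hdir : ∀ i j, ∃ k, f i ≤ᵐ[P] f k ∧ f j ≤ᵐ[P] f k)
    {K : ℝ≥0∞} (hK : K ≠ ∞) (hfK : ∀ i, ∫⁻ ω, f i ω ∂P ≤ K) :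
    ∃ u : ℕ → ι, (∀ n, f (u n) ≤ᵐ[P] f (u (n + 1))) ∧ g =ᵐ[P] fun ω => ⨆ n, f (u n) ω := by
  have hf0 : ∀ i, Measurable[m0] (f i) := fun i => (hf i).mono hm le_rfl
  obtain ⟨w, -, hw, hwv⟩ := exists_seq_tendsto_sSup (Set.range_nonempty fun i => ∫⁻ ω, f i ω ∂P)
    (OrderTop.bddAbove _)
  choose v hv using hwv
  choose D hD1 hD2 using hdir
  let u : ℕ → ι := fun n => Nat.rec (v 0) (fun n i => D i (v (n + 1))) n
  have hu : ∀ n, f (u n) ≤ᵐ[P] f (u (n + 1)) := fun n => hD1 (u n) (v (n + 1))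
  have huv : ∀ n, f (v n) ≤ᵐ[P] f (u n) := fun n => by
    cases n with
    | zero => exact EventuallyLE.rfl
    | succ n => exact hD2 (u n) (v (n + 1))
  let g₀ : Ω → ℝ≥0∞ := fun ω => ⨆ n, f (u n) ω
  have hg₀m : Measurable[m0] g₀ := Measurable.iSup fun n => hf0 (u n)
  have humono : ∀ᵐ ω ∂P, Monotone fun n => f (u n) ω := by
    filter_upwards [ae_all_iff.2 hu] with ω hω using monotone_nat_of_le_succ hω
  have hM : ∀ i, ∫⁻ ω, f i ω ∂P ≤ ∫⁻ ω, g₀ ω ∂P := fun i => by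
    refine (le_sSup (Set.mem_range_self i)).trans (le_of_tendsto' hw fun n => ?_)
    rw [← hv n]
    exact lintegral_mono_ae ((huv n).mono fun ω hω => hω.trans (le_iSup (fun n => f (u n) ω) n))
  have hg₀ : ∫⁻ ω, g₀ ω ∂P ≠ ∞ := by
    refine ne_top_of_le_ne_top hK ?_
    rw [show ∫⁻ ω, g₀ ω ∂P = _ from
      lintegral_iSup' (μ := P) (fun n => (hf0 (u n)).aemeasurable) humono]
    exact iSup_le fun n => hfK _
  -- `g₀` has the largest possible integral, so adjoining `f i` to the sequence cannot increase it
  have hle : ∀ i, f i ≤ᵐ[P] g₀ := fun i => by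
    have hmax : ∫⁻ ω, ⨆ n, max (f (u n) ω) (f i ω) ∂P ≤ ∫⁻ ω, g₀ ω ∂P := by
      rw [lintegral_iSup' (μ := P) (fun n => ((hf0 (u n)).max (hf0 i)).aemeasurable)
        (humono.mono fun ω hω a b hab => max_le_max (hω hab) le_rfl)]
      refine iSup_le fun n => le_trans (lintegral_mono_ae ?_) (hM (D (u n) i))
      filter_upwards [hD1 (u n) i, hD2 (u n) i] with ω h1 h2 using max_le h1 h2
    have heq := ae_eq_of_ae_le_of_lintegral_le
      (Eventually.of_forall fun ω => iSup_mono fun n => le_max_left (f (u n) ω) (f i ω)) hg₀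
      (Measurable.iSup (mδ := m0) fun n => (hf0 (u n)).max (hf0 i)).aemeasurable hmax
    filter_upwards [heq] with ω hω
    calc f i ω ≤ ⨆ n, max (f (u n) ω) (f i ω) :=
          (le_max_right _ _).trans (le_iSup (fun n => max (f (u n) ω) (f i ω)) 0)
      _ = g₀ ω := hω.symm
  refine ⟨u, hu, (hg.least g₀ hg₀m hle).antisymm ?_⟩
  filter_upwards [ae_all_iff.2 fun n => hg.le (u n)] with ω hω using iSup_le hω

variable [IsFiniteMeasure P]

/-! ### Comparison of random variables through their integrals -/

theorem ae_le_of_setLIntegral_le {m : MeasurableSpace Ω} (hm : m ≤ m0) {f g : Ω → ℝ≥0∞}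
    (hf : Measurable[m] f) (hg : Measurable[m] g)
    (h : ∀ A, MeasurableSet[m] A → ∫⁻ ω in A, f ω ∂P ≤ ∫⁻ ω in A, g ω ∂P) : f ≤ᵐ[P] g := by
  apply ae_le_of_ae_le_trim (hm := hm)
  apply ae_le_of_forall_setLIntegral_le_of_sigmaFinite hf
  intro s hs _
  rw [setLIntegral_trim hm hf hs, setLIntegral_trim hm hg hs]
  exact h s hs

theorem ae_eq_of_setLIntegral_eq {m : MeasurableSpace Ω} (hm : m ≤ m0) {f g : Ω → ℝ≥0∞}
    (hf : Measurable[m] f) (hg : Measurable[m] g)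
    (h : ∀ A, MeasurableSet[m] A → ∫⁻ ω in A, f ω ∂P = ∫⁻ ω in A, g ω ∂P) : f =ᵐ[P] g :=
  (ae_le_of_setLIntegral_le hm hf hg fun A hA => (h A hA).le).antisymm
    (ae_le_of_setLIntegral_le hm hg hf fun A hA => (h A hA).ge)

theorem condLExp_le_of_setLIntegral_le {m : MeasurableSpace Ω} (hm : m ≤ m0) {X g : Ω → ℝ≥0∞}
    (hg : Measurable[m] g)
    (h : ∀ A, MeasurableSet[m] A → ∫⁻ ω in A, X ω ∂P ≤ ∫⁻ ω in A, g ω ∂P) :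
    condLExp m P X ≤ᵐ[P] g :=
  ae_le_of_setLIntegral_le hm (measurable_condLExp m P X) hg fun A hA => by
    rw [setLIntegral_condLExp hm P X hA]
    exact h A hA

theorem condLExp_le_condLExp_of_setLIntegral_le {m : MeasurableSpace Ω} (hm : m ≤ m0)
    {X Y : Ω → ℝ≥0∞}
    (h : ∀ A, MeasurableSet[m] A → ∫⁻ ω in A, X ω ∂P ≤ ∫⁻ ω in A, Y ω ∂P) :
    condLExp m P X ≤ᵐ[P] condLExp m P Y :=
  condLExp_le_of_setLIntegral_le hm (measurable_condLExp m P Y) fun A hA => by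
    rw [setLIntegral_condLExp hm P Y hA]
    exact h A hA

/-! ### Limits and conditional expectations under uniformly small tails -/

theorem UniformTail.exists_lintegral_le {ι : Type*} {X : ι → Ω → ℝ≥0∞} (h : UniformTail P X) :
    ∃ K : ℝ≥0∞, K ≠ ∞ ∧ ∀ i, ∫⁻ ω, X i ω ∂P ≤ K := by
  obtain ⟨C, hC⟩ := h 1 one_ne_zero
  refine ⟨1 + C * P Set.univ, by finiteness, fun i => ?_⟩
  calc ∫⁻ ω, X i ω ∂P ≤ ∫⁻ ω, ((X i ω - C) + C) ∂P := lintegral_mono fun ω => le_tsub_add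
    _ = ∫⁻ ω, (X i ω - C) ∂P + C * P Set.univ := by
        rw [lintegral_add_right _ measurable_const, lintegral_const]
    _ ≤ _ := by gcongr; exact hC i

/-- Vitali's convergence theorem, on every set. -/
theorem UniformTail.tendsto_setLIntegral {X : ℕ → Ω → ℝ≥0∞} {Y : Ω → ℝ≥0∞}
    (h : UniformTail P X) (hX : ∀ n, Measurable (X n))
    (hlim : ∀ᵐ ω ∂P, Tendsto (fun n => X n ω) atTop (𝓝 (Y ω))) (A : Set Ω) :
    Tendsto (fun n => ∫⁻ ω in A, X n ω ∂P) atTop (𝓝 (∫⁻ ω in A, Y ω ∂P)) := by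
  have hlimA : ∀ᵐ ω ∂(P.restrict A), Tendsto (fun n => X n ω) atTop (𝓝 (Y ω)) :=
    ae_restrict_of_ae hlim
  refine tendsto_of_le_liminf_of_limsup_le ?_ ?_
  · calc ∫⁻ ω in A, Y ω ∂P = ∫⁻ ω in A, liminf (fun n => X n ω) atTop ∂P :=
          lintegral_congr_ae (hlimA.mono fun ω hω => hω.liminf_eq.symm)
      _ ≤ _ := lintegral_liminf_le hX
  · refine ENNReal.le_of_forall_pos_le_add fun ε hε _ => ?_
    obtain ⟨C, hC⟩ := h ε (by exact_mod_cast hε.ne')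
    have hb : ∀ n, ∫⁻ ω in A, X n ω ∂P ≤ ∫⁻ ω in A, min (X n ω) C ∂P + ε := fun n => by
      calc ∫⁻ ω in A, X n ω ∂P ≤ ∫⁻ ω in A, (min (X n ω) C + (X n ω - C)) ∂P := by
            refine lintegral_mono fun ω => ?_
            rcases le_total (X n ω) C with hc | hc
            · simp [hc]
            · simp [hc, add_tsub_cancel_of_le hc]
        _ = ∫⁻ ω in A, min (X n ω) C ∂P + ∫⁻ ω in A, (X n ω - C) ∂P := by
            rw [lintegral_add_left ((hX n).min measurable_const)]
        _ ≤ _ := by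
            gcongr
            exact (setLIntegral_le_lintegral _ _).trans (hC n)
    have hd : Tendsto (fun n => ∫⁻ ω in A, min (X n ω) C ∂P) atTop
        (𝓝 (∫⁻ ω in A, min (Y ω) C ∂P)) := by
      refine tendsto_lintegral_of_dominated_convergence (fun _ => (C : ℝ≥0∞))
        (fun n => (hX n).min measurable_const)
        (fun n => Eventually.of_forall fun ω => min_le_right _ _)
        (by simp; finiteness) ?_
      filter_upwards [hlimA] with ω hω using hω.min tendsto_const_nhds
    calc limsup (fun n => ∫⁻ ω in A, X n ω ∂P) atTop
        ≤ limsup (fun n => ∫⁻ ω in A, min (X n ω) C ∂P + ε) atTop :=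
          limsup_le_limsup (Eventually.of_forall hb)
      _ = ∫⁻ ω in A, min (Y ω) C ∂P + ε := (hd.add tendsto_const_nhds).limsup_eq
      _ ≤ _ := by gcongr; exact min_le_left _ _

theorem UniformTail.tendsto_lintegral {X : ℕ → Ω → ℝ≥0∞} {Y : Ω → ℝ≥0∞}
    (h : UniformTail P X) (hX : ∀ n, Measurable (X n))
    (hlim : ∀ᵐ ω ∂P, Tendsto (fun n => X n ω) atTop (𝓝 (Y ω))) :
    Tendsto (fun n => ∫⁻ ω, X n ω ∂P) atTop (𝓝 (∫⁻ ω, Y ω ∂P)) := by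
  simpa using h.tendsto_setLIntegral hX hlim Set.univ

/-- Conditional expectation does not increase the excess over a constant (conditional Jensen
inequality for `x ↦ (x - C)⁺`). -/
theorem lintegral_condLExp_tsub_le {m : MeasurableSpace Ω} (hm : m ≤ m0) (X : Ω → ℝ≥0∞) (C : ℝ≥0) :
    ∫⁻ ω, (condLExp m P X ω - C) ∂P ≤ ∫⁻ ω, (X ω - C) ∂P := by
  have h1 : condLExp m P X ≤ᵐ[P] condLExp m P (fun ω => X ω - C) + fun _ => (C : ℝ≥0∞) := by
    refine (condLExp_mono (Eventually.of_forall fun ω => ?_)).trans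
      ((condLExp_add_right (mΩ := m) (fun ω => X ω - C)
        (measurable_const (a := (C : ℝ≥0∞))).aemeasurable).trans ?_).le
    · exact le_tsub_add
    · rw [condLExp_const hm]
  calc ∫⁻ ω, (condLExp m P X ω - C) ∂P ≤ ∫⁻ ω, condLExp m P (fun ω => X ω - C) ω ∂P := by
        refine lintegral_mono_ae (h1.mono fun ω hω => ?_)
        exact tsub_le_iff_right.2 hω
    _ = _ := lintegral_condLExp hm P _

/-! ### Convergence of nonnegative supermartingales -/

/-- A sequence in `[0, ∞)` converges in `[0, ∞]` if it does not oscillate across any interval; the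
oscillation is stated for `-x`, the form in which upcrossings of submartingales control it. -/
theorem exists_tendsto_of_not_frequently {x : ℕ → ℝ≥0∞} (hx : ∀ n, x n ≠ ∞) {s : Set ℝ≥0∞}
    (hs : Dense s)
    (h : ∀ a ∈ s, ∀ b ∈ s, a < b → b ≠ ∞ → ¬((∃ᶠ n in atTop, -(x n).toReal < -b.toReal) ∧
      ∃ᶠ n in atTop, -a.toReal < -(x n).toReal)) :
    ∃ c, Tendsto x atTop (𝓝 c) := by
  refine tendsto_of_no_upcrossings hs fun a ha b hb hab ⟨h1, h2⟩ => ?_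
  obtain ⟨n, hn⟩ := h2.exists
  have hb' : b ≠ ∞ := hn.ne_top
  refine h a ha b hb hab hb' ⟨h2.mono fun n hn => ?_, h1.mono fun n hn => ?_⟩
  · exact neg_lt_neg ((ENNReal.toReal_lt_toReal hb' (hx n)).2 hn)
  · exact neg_lt_neg ((ENNReal.toReal_lt_toReal (hx n) hab.ne_top).2 hn)

theorem submartingale_neg_toReal {G : Filtration ℕ m0} {X : ℕ → Ω → ℝ≥0∞}
    (hX : ∀ n, Measurable[G n] (X n)) (hfin : ∀ n, ∫⁻ ω, X n ω ∂P ≠ ∞)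
    (h : ∀ n A, MeasurableSet[G n] A → ∫⁻ ω in A, X (n + 1) ω ∂P ≤ ∫⁻ ω in A, X n ω ∂P) :
    Submartingale (fun n ω => -(X n ω).toReal) G P := by
  have hX0 : ∀ n, Measurable (X n) := fun n => (hX n).mono (G.le n) le_rfl
  refine submartingale_of_setIntegral_le_succ (fun n => ?_) (fun n => ?_) fun n A hA => ?_
  · exact (hX n).ennreal_toReal.neg.stronglyMeasurable
  · exact (integrable_toReal_of_lintegral_ne_top (hX0 n).aemeasurable (hfin n)).neg
  · have hA' : ∀ n, ∫⁻ ω in A, X n ω ∂P ≠ ∞ := fun n =>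
      ne_top_of_le_ne_top (hfin n) (setLIntegral_le_lintegral _ _)
    rw [integral_neg, integral_neg, neg_le_neg_iff,
      integral_toReal (hX0 _).aemeasurable (ae_lt_top (hX0 _) (hA' _)),
      integral_toReal (hX0 _).aemeasurable (ae_lt_top (hX0 _) (hA' _))]
    exact ENNReal.toReal_mono (hA' n) (h n A hA)

/-- Doob's upcrossing estimate for the negative of a nonnegative supermartingale: the bound does
not depend on the process. -/
theorem lintegral_upcrossings_le {G : Filtration ℕ m0} {X : ℕ → Ω → ℝ≥0∞}
    (hX : Submartingale (fun n ω => -(X n ω).toReal) G P) {a b : ℝ} (hab : a < b) :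
    ∫⁻ ω, upcrossings a b (fun n ω => -(X n ω).toReal) ω ∂P
      ≤ ENNReal.ofReal |a| * P Set.univ / ENNReal.ofReal (b - a) := by
  rw [ENNReal.le_div_iff_mul_le (Or.inl (by simpa using hab)) (Or.inl ENNReal.ofReal_ne_top),
    mul_comm]
  refine (hX.mul_lintegral_upcrossings_le_lintegral_pos_part a b).trans (iSup_le fun N => ?_)
  rw [← lintegral_const]
  refine lintegral_mono fun ω => ENNReal.ofReal_le_ofReal ?_
  have : 0 ≤ (X N ω).toReal := ENNReal.toReal_nonneg
  refine sup_le ?_ (abs_nonneg a)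
  linarith [neg_abs_le a]

/-- Almost sure convergence of a nonnegative supermartingale, with the supermartingale property
stated through set integrals. -/
theorem exists_tendsto_of_supermartingale {G : ℕ → MeasurableSpace Ω} (hG : ∀ n, G n ≤ m0)
    (hmono : Monotone G) {X : ℕ → Ω → ℝ≥0∞} (hX : ∀ n, Measurable[G n] (X n))
    (hfin : ∀ n, ∫⁻ ω, X n ω ∂P ≠ ∞)
    (h : ∀ n A, MeasurableSet[G n] A → ∫⁻ ω in A, X (n + 1) ω ∂P ≤ ∫⁻ ω in A, X n ω ∂P) :
    ∀ᵐ ω ∂P, ∃ c, Tendsto (fun n => X n ω) atTop (𝓝 c) := by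
  obtain ⟨s, hsc, hsd⟩ := TopologicalSpace.exists_countable_dense ℝ≥0∞
  have hsub := submartingale_neg_toReal (G := ⟨G, hmono, hG⟩) hX hfin h
  have hne : ∀ᵐ ω ∂P, ∀ n, X n ω ≠ ∞ := ae_all_iff.2 fun n =>
    (ae_lt_top ((hX n).mono (hG n) le_rfl) (hfin n)).mono fun ω hω => hω.ne
  have hup : ∀ᵐ ω ∂P, ∀ a ∈ s, ∀ b ∈ s, a < b → b ≠ ∞ →
      upcrossings (-b.toReal) (-a.toReal) (fun n ω => -(X n ω).toReal) ω ≠ ∞ := by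
    refine (ae_ball_iff hsc).2 fun a ha => (ae_ball_iff hsc).2 fun b hb => ?_
    by_cases hab : a < b ∧ b ≠ ∞
    · have hab' : -b.toReal < -a.toReal :=
        neg_lt_neg ((ENNReal.toReal_lt_toReal hab.1.ne_top hab.2).2 hab.1)
      have hlt := ae_lt_top (hsub.stronglyAdapted.measurable_upcrossings hab')
        (ne_top_of_le_ne_top (ENNReal.div_ne_top (by finiteness) (by simpa using hab'))
          (lintegral_upcrossings_le hsub hab'))
      filter_upwards [hlt] with ω hω _ _ using hω.ne
    · exact Eventually.of_forall fun ω h1 h2 => absurd ⟨h1, h2⟩ hab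
  filter_upwards [hne, hup] with ω h1 h2
  refine exists_tendsto_of_not_frequently h1 hsd fun a ha b hb hab hb' => ?_
  exact not_frequently_of_upcrossings_lt_top
    (neg_lt_neg ((ENNReal.toReal_lt_toReal hab.ne_top hb').2 hab)) (h2 a ha b hb hab hb')

/-- A sequence that oscillates infinitely often has many upcrossings when read backwards from a
late time; here only the indices `≥ j` are used. -/
theorem le_upcrossingsBefore_reverse {f : ℕ → Ω → ℝ} {ω : Ω} {a b : ℝ} (hab : a < b)
    (h1 : ∃ᶠ n in atTop, f n ω < a) (h2 : ∃ᶠ n in atTop, b < f n ω) (K : ℕ) :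
    ∀ j, ∃ N₀, j ≤ N₀ ∧ ∀ N, N₀ ≤ N →
      K ≤ upcrossingsBefore a b (fun k => f (N - k)) (N + 1 - j) ω := by
  induction K with
  | zero => exact fun j => ⟨j, le_rfl, fun N _ => Nat.zero_le _⟩
  | succ K ih =>
    intro j
    obtain ⟨q, hjq, hq⟩ := frequently_atTop.1 h2 j
    obtain ⟨p, hqp, hp⟩ := frequently_atTop.1 h1 q
    obtain ⟨N₀, hN₀, hN⟩ := ih (p + 1)
    refine ⟨N₀, by omega, fun N hNN => ?_⟩
    have hlt := upcrossingsBefore_lt_of_exists_upcrossing (f := fun k => f (N - k)) (ω := ω) hab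
      (N := N + 1 - (p + 1)) (N₁ := N - p) (N₂ := N - q) (by omega)
      (by rwa [Nat.sub_sub_self (by omega : p ≤ N)]) (by omega)
      (by rwa [Nat.sub_sub_self (by omega : q ≤ N)])
    exact (Nat.succ_le_of_lt ((hN N hNN).trans_lt hlt)).trans
      (upcrossingsBefore_mono hab (by omega : N - q + 1 ≤ N + 1 - j) ω)

/-- Almost sure convergence of a nonnegative supermartingale indexed by decreasing σ-algebras. The
numbers of upcrossings of the reversed segments `X N, …, X 0` are bounded in mean, so their lower
limit is almost surely finite by Fatou's lemma, whereas it is infinite where `X` oscillates. -/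
theorem exists_tendsto_of_backward_supermartingale {G : ℕ → MeasurableSpace Ω}
    (hG : ∀ n, G n ≤ m0) (hanti : Antitone G) {X : ℕ → Ω → ℝ≥0∞}
    (hX : ∀ n, Measurable[G n] (X n)) (hfin : ∀ n, ∫⁻ ω, X n ω ∂P ≠ ∞)
    (h : ∀ n A, MeasurableSet[G (n + 1)] A →
      ∫⁻ ω in A, X n ω ∂P ≤ ∫⁻ ω in A, X (n + 1) ω ∂P) :
    ∀ᵐ ω ∂P, ∃ c, Tendsto (fun n => X n ω) atTop (𝓝 c) := by
  obtain ⟨s, hsc, hsd⟩ := TopologicalSpace.exists_countable_dense ℝ≥0∞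
  -- truncated subtraction freezes the reversed segment after it has reached the index `0`
  let GN : ℕ → Filtration ℕ m0 := fun N =>
    ⟨fun k => G (N - k), fun i j hij => hanti (Nat.sub_le_sub_left hij N), fun k => hG _⟩
  have hsub : ∀ N, Submartingale (fun k ω => -(X (N - k) ω).toReal) (GN N) P := fun N => by
    refine submartingale_neg_toReal (X := fun k => X (N - k)) (fun n => hX _) (fun n => hfin _)
      fun n A hA => ?_
    rcases lt_or_ge n N with hn | hn
    · obtain ⟨i, hi⟩ : ∃ i, N - n = i + 1 := ⟨N - n - 1, by omega⟩
      have hi' : N - (n + 1) = i := by omega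
      rw [hi, hi']
      exact h i A (by rw [← hi]; exact hA)
    · rw [Nat.sub_eq_zero_of_le hn, Nat.sub_eq_zero_of_le (hn.trans (Nat.le_succ n))]
  have hne : ∀ᵐ ω ∂P, ∀ n, X n ω ≠ ∞ := ae_all_iff.2 fun n =>
    (ae_lt_top ((hX n).mono (hG n) le_rfl) (hfin n)).mono fun ω hω => hω.ne
  have hup : ∀ᵐ ω ∂P, ∀ a ∈ s, ∀ b ∈ s, a < b → b ≠ ∞ →
      liminf (fun N => upcrossings (-b.toReal) (-a.toReal)
        (fun k ω => -(X (N - k) ω).toReal) ω) atTop ≠ ∞ := by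
    refine (ae_ball_iff hsc).2 fun a ha => (ae_ball_iff hsc).2 fun b hb => ?_
    by_cases hab : a < b ∧ b ≠ ∞
    · have hab' : -b.toReal < -a.toReal :=
        neg_lt_neg ((ENNReal.toReal_lt_toReal hab.1.ne_top hab.2).2 hab.1)
      have hm : ∀ N, Measurable (upcrossings (-b.toReal) (-a.toReal)
        (fun k ω => -(X (N - k) ω).toReal)) := fun N =>
          (hsub N).stronglyAdapted.measurable_upcrossings hab'
      have hint := (lintegral_liminf_le (μ := P) (f := fun N => upcrossings (-b.toReal) (-a.toReal)
        (fun k ω => -(X (N - k) ω).toReal)) (u := atTop) hm).trans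
        (liminf_le_of_frequently_le' (Frequently.of_forall fun N =>
          lintegral_upcrossings_le (hsub N) hab'))
      have hlt := ae_lt_top (μ := P) (Measurable.liminf hm)
        (ne_top_of_le_ne_top (ENNReal.div_ne_top (by finiteness) (by simpa using hab')) hint)
      filter_upwards [hlt] with ω hω _ _ using hω.ne
    · exact Eventually.of_forall fun ω h1 h2 => absurd ⟨h1, h2⟩ hab
  filter_upwards [hne, hup] with ω h1 h2
  refine exists_tendsto_of_not_frequently h1 hsd fun a ha b hb hab hb' ⟨hf1, hf2⟩ => ?_
  refine h2 a ha b hb hab hb' (ENNReal.eq_top_of_forall_nnreal_le fun r => ?_)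
  obtain ⟨K, hK⟩ := exists_nat_ge r
  obtain ⟨N₀, -, hN₀⟩ := le_upcrossingsBefore_reverse (f := fun n ω => -(X n ω).toReal)
    (neg_lt_neg ((ENNReal.toReal_lt_toReal hab.ne_top hb').2 hab)) hf1 hf2 K 0
  refine le_liminf_of_le (by isBoundedDefault) (eventually_atTop.2 ⟨N₀, fun N hN => ?_⟩)
  refine le_trans ?_ (le_iSup (fun M => (upcrossingsBefore (-b.toReal) (-a.toReal)
    (fun k ω => -(X (N - k) ω).toReal) M ω : ℝ≥0∞)) (N + 1 - 0))
  calc (r : ℝ≥0∞) ≤ K := by exact_mod_cast hK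
    _ ≤ _ := by exact_mod_cast hN₀ N hN

/-- Lévy's upward theorem for conditional expectations of nonnegative functions. -/
theorem tendsto_condLExp {G : ℕ → MeasurableSpace Ω} (hG : ∀ n, G n ≤ m0) (hmono : Monotone G)
    {X : Ω → ℝ≥0∞} (hX : Measurable[⨆ n, G n] X) (hfin : ∫⁻ ω, X ω ∂P ≠ ∞) :
    ∀ᵐ ω ∂P, Tendsto (fun n => condLExp (G n) P X ω) atTop (𝓝 (X ω)) := by
  have hX0 : Measurable X := hX.mono (iSup_le hG) le_rfl
  have h1 := (integrable_toReal_of_lintegral_ne_top hX0.aemeasurable hfin).tendsto_ae_condExp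
    (ℱ := ⟨G, hmono, hG⟩) hX.ennreal_toReal.stronglyMeasurable
  filter_upwards [h1, ae_all_iff.2 fun n => toReal_condLExp (G n) hX0.aemeasurable hfin,
    ae_all_iff.2 fun n => condLExp_ne_top (mΩ := G n) hfin, ae_lt_top hX0 hfin]
    with ω h1 h2 h3 h4
  rw [← ENNReal.tendsto_toReal_iff h3 h4.ne]
  exact h1.congr fun n => (h2 n).symm

end Generic

/-! ### Stopping times under the usual conditions -/

section Times

variable {Ω : Type*} {m0 : MeasurableSpace Ω} {T : ℝ≥0} {𝓕 : Filtration (TimeSet T) m0}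
  {P : Measure Ω}

theorem isStopping_iff {τ : Ω → TimeSet T} :
    IsStopping 𝓕 τ ↔ ∀ t, MeasurableSet[𝓕 t] {ω | τ ω ≤ t} := by
  simp [IsStopping, IsStoppingTime]

theorem IsStopping.measurableSet_le {τ : Ω → TimeSet T} (h : IsStopping 𝓕 τ) (t : TimeSet T) :
    MeasurableSet[𝓕 t] {ω | τ ω ≤ t} := isStopping_iff.1 h t

theorem IsStopping.measurableSet_lt {τ : Ω → TimeSet T} (h : IsStopping 𝓕 τ) (t : TimeSet T) :
    MeasurableSet[𝓕 t] {ω | τ ω < t} := by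
  simpa using IsStoppingTime.measurableSet_lt h t

theorem IsStopping.measurableSet_gt {τ : Ω → TimeSet T} (h : IsStopping 𝓕 τ) (t : TimeSet T) :
    MeasurableSet[𝓕 t] {ω | t < τ ω} := by
  convert (h.measurableSet_le t).compl using 1
  ext ω
  simp

theorem isStopping_const (t : TimeSet T) : IsStopping 𝓕 (fun _ => t) :=
  isStopping_iff.2 fun _ => MeasurableSet.const _

theorem IsStopping.max {τ τ' : Ω → TimeSet T} (h : IsStopping 𝓕 τ) (h' : IsStopping 𝓕 τ') :
    IsStopping 𝓕 (fun ω => max (τ ω) (τ' ω)) := isStopping_iff.2 fun t => by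
  simpa only [max_le_iff, Set.ofPred_and] using (h.measurableSet_le t).inter (h'.measurableSet_le t)

theorem IsStopping.min {τ τ' : Ω → TimeSet T} (h : IsStopping 𝓕 τ) (h' : IsStopping 𝓕 τ') :
    IsStopping 𝓕 (fun ω => min (τ ω) (τ' ω)) := isStopping_iff.2 fun t => by
  simpa only [min_le_iff, Set.ofPred_or] using (h.measurableSet_le t).union (h'.measurableSet_le t)

/-- Completeness: every σ-algebra above `𝓕 0` is stable under modification on null sets. -/
theorem UsualConditions.measurableSet_congr (hu : UsualConditions 𝓕 P) {m : MeasurableSpace Ω}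
    (hm : 𝓕 ⊥ ≤ m) {A B : Set Ω} (hA : MeasurableSet[m] A) (h : ∀ᵐ ω ∂P, ω ∈ A ↔ ω ∈ B) :
    MeasurableSet[m] B := by
  have hnull : ∀ C : Set Ω, (∀ ω ∈ C, ¬(ω ∈ A ↔ ω ∈ B)) → MeasurableSet[m] C := fun C hC =>
    hm _ (hu.complete _ (measure_mono_null hC h))
  have h1 : MeasurableSet[m] (A \ B) := hnull _ fun ω hω hiff => hω.2 (hiff.1 hω.1)
  have h2 : MeasurableSet[m] (B \ A) := hnull _ fun ω hω hiff => hω.2 (hiff.2 hω.1)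
  have e : B = (A \ (A \ B)) ∪ (B \ A) := by
    ext ω
    simp only [Set.mem_union, Set.mem_sdiff]
    tauto
  rw [e]
  exact (hA.diff h1).union h2

/-- Right continuity of the filtration at the instants before `T`, where it is an intersection. -/
theorem UsualConditions.measurableSet_of_forall_gt (hu : UsualConditions 𝓕 P) {t : TimeSet T}
    (ht : t < ⊤) {A : Set Ω} (h : ∀ q, t < q → MeasurableSet[𝓕 q] A) : MeasurableSet[𝓕 t] A := by
  have := hu.rightContinuous
  apply Filtration.IsRightContinuous.measurableSet
  rw [Filtration.rightCont_eq_of_not_isMax _ (fun hmax => ht.not_ge (hmax le_top))]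
  simp only [MeasurableSpace.measurableSet_iInf]
  exact h

theorem UsualConditions.isStopping_of_lt (hu : UsualConditions 𝓕 P) {τ : Ω → TimeSet T}
    (h : ∀ t, MeasurableSet[𝓕 t] {ω | τ ω < t}) : IsStopping 𝓕 τ := by
  refine isStopping_iff.2 fun t => ?_
  rcases eq_or_lt_of_le (le_top : t ≤ ⊤) with rfl | ht
  · simp
  refine hu.measurableSet_of_forall_gt ht fun q hq => ?_
  obtain ⟨v, -, hv, hvt⟩ := exists_seq_strictAnti_tendsto' hq
  have e : {ω | τ ω ≤ t} = ⋂ n, {ω | τ ω < v n} := by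
    ext ω
    simp only [Set.mem_ofPred_eq, Set.mem_iInter]
    exact ⟨fun hω n => hω.trans_lt (hv n).1, fun hω => ge_of_tendsto' hvt fun n => (hω n).le⟩
  rw [e]
  exact MeasurableSet.iInter fun n => 𝓕.mono (hv n).2.le _ (h (v n))

/-- The pointwise infimum of a sequence of random times. -/
noncomputable def infTime (X : ℕ → Ω → TimeSet T) (ω : Ω) : TimeSet T :=
  ⟨⨅ k, (X k ω : ℝ≥0), Set.mem_Iic.2 ((ciInf_le (OrderBot.bddBelow _) 0).trans (X 0 ω).2)⟩

theorem infTime_le (X : ℕ → Ω → TimeSet T) (k : ℕ) (ω : Ω) : infTime X ω ≤ X k ω :=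
  Subtype.coe_le_coe.1 (ciInf_le (OrderBot.bddBelow (Set.range fun k => (X k ω : ℝ≥0))) k)

theorem le_infTime {X : ℕ → Ω → TimeSet T} {ω : Ω} {t : TimeSet T} (h : ∀ k, t ≤ X k ω) :
    t ≤ infTime X ω :=
  Subtype.coe_le_coe.1 (le_ciInf fun k => Subtype.coe_le_coe.2 (h k))

theorem infTime_lt_iff {X : ℕ → Ω → TimeSet T} {ω : Ω} {t : TimeSet T} :
    infTime X ω < t ↔ ∃ k, X k ω < t := by
  constructor
  · intro h
    by_contra! hc
    exact (le_infTime hc).not_gt h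
  · rintro ⟨k, hk⟩
    exact (infTime_le X k ω).trans_lt hk

theorem UsualConditions.isStopping_infTime (hu : UsualConditions 𝓕 P) {X : ℕ → Ω → TimeSet T}
    (hX : ∀ k, IsStopping 𝓕 (X k)) : IsStopping 𝓕 (infTime X) := by
  refine hu.isStopping_of_lt fun t => ?_
  simp only [infTime_lt_iff, Set.ofPred_exists]
  exact MeasurableSet.iUnion fun k => (hX k).measurableSet_lt t

theorem monotone_infTime_tail (X : ℕ → Ω → TimeSet T) (ω : Ω) :
    Monotone fun n => infTime (fun k => X (n + k)) ω := fun a b hab => by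
  refine le_infTime fun k => ?_
  convert infTime_le (fun k => X (a + k)) (b - a + k) ω using 2
  omega

theorem tendsto_infTime_tail {X : ℕ → Ω → TimeSet T} {ω : Ω} {t : TimeSet T}
    (h : Tendsto (fun k => X k ω) atTop (𝓝 t)) :
    Tendsto (fun n => infTime (fun k => X (n + k)) ω) atTop (𝓝 t) := by
  refine tendsto_order.2 ⟨fun a ha => ?_, fun b hb => ?_⟩
  · obtain ⟨c, hac, hct⟩ := exists_between ha
    obtain ⟨N, hN⟩ := eventually_atTop.1 (h.eventually_const_lt hct)
    refine eventually_atTop.2 ⟨N, fun n hn => hac.trans_le (le_infTime fun k => ?_)⟩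
    exact (hN _ (by omega)).le
  · filter_upwards [h.eventually_lt_const hb] with n hn
    exact infTime_lt_iff.2 ⟨0, hn⟩

/-- Limits of stopping times are stopping times, and a limit that is eventually approached from
strictly below is foretold by the tail infima of the sequence. -/
theorem UsualConditions.exists_predictableTime_of_tendsto (hu : UsualConditions 𝓕 P)
    {X : ℕ → Ω → TimeSet T} (hX : ∀ k, IsStopping 𝓕 (X k)) {θ : Ω → TimeSet T}
    (hlim : ∀ᵐ ω ∂P, Tendsto (fun k => X k ω) atTop (𝓝 (θ ω)))
    (hlt : ∀ᵐ ω ∂P, ⊥ < θ ω → ∀ᶠ k in atTop, X k ω < θ ω) :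
    ∃ τ : PredictableTime 𝓕 P, τ.time = θ := by
  have hY : ∀ n, IsStopping 𝓕 (infTime fun k => X (n + k)) := fun n =>
    hu.isStopping_infTime fun k => hX _
  refine ⟨⟨θ, ?_, fun n => infTime fun k => X (n + k), hY, ?_⟩, rfl⟩
  · refine isStopping_iff.2 fun t => ?_
    refine hu.measurableSet_congr (𝓕.mono bot_le)
      (MeasurableSet.iInter fun n => (hY n).measurableSet_le t) ?_
    filter_upwards [hlim] with ω hω
    simp only [Set.mem_iInter, Set.mem_ofPred_eq]
    have := tendsto_infTime_tail hω
    exact ⟨fun h => le_of_tendsto' this h,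
      fun h n => ((monotone_infTime_tail X ω).ge_of_tendsto this n).trans h⟩
  · filter_upwards [hlim, hlt] with ω h1 h2
    refine ⟨monotone_infTime_tail X ω, tendsto_infTime_tail h1, fun h n => ?_⟩
    obtain ⟨k, hk, hnk⟩ := ((h2 h).and (eventually_ge_atTop n)).exists
    refine infTime_lt_iff.2 ⟨k - n, ?_⟩
    rwa [Nat.add_sub_cancel' hnk]

/-! ### Constructions of predictable times -/

theorem exists_predictableTime_const (hu : UsualConditions 𝓕 P) (t : TimeSet T) :
    ∃ τ : PredictableTime 𝓕 P, τ.time = fun _ => t := by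
  rcases eq_or_lt_of_le (bot_le : ⊥ ≤ t) with rfl | ht
  · exact hu.exists_predictableTime_of_tendsto (X := fun _ _ => ⊥) (fun _ => isStopping_const _)
      (by simp) (by simp)
  · obtain ⟨v, -, hv, hvt⟩ := exists_seq_strictMono_tendsto' ht
    exact hu.exists_predictableTime_of_tendsto (X := fun k _ => v k) (fun _ => isStopping_const _)
      (Eventually.of_forall fun _ => hvt)
      (Eventually.of_forall fun _ _ => Eventually.of_forall fun k => (hv k).2)

theorem exists_predictableTime_max (hu : UsualConditions 𝓕 P) (τ τ' : PredictableTime 𝓕 P) :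
    ∃ θ : PredictableTime 𝓕 P, θ.time = fun ω => max (τ.time ω) (τ'.time ω) := by
  obtain ⟨σ, hσ, hf⟩ := τ.foretold
  obtain ⟨σ', hσ', hf'⟩ := τ'.foretold
  refine hu.exists_predictableTime_of_tendsto (X := fun k ω => max (σ k ω) (σ' k ω))
    (fun k => (hσ k).max (hσ' k)) ?_ ?_
  · filter_upwards [hf, hf'] with ω h h' using h.2.1.max h'.2.1
  · filter_upwards [hf, hf'] with ω h h' hpos
    refine Eventually.of_forall fun k => max_lt ?_ ?_
    · rcases eq_or_lt_of_le (bot_le : ⊥ ≤ τ.time ω) with h0 | h0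
      · exact (h.1.ge_of_tendsto h.2.1 k).trans_lt (h0 ▸ hpos)
      · exact (h.2.2 h0 k).trans_le (le_max_left _ _)
    · rcases eq_or_lt_of_le (bot_le : ⊥ ≤ τ'.time ω) with h0 | h0
      · exact (h'.1.ge_of_tendsto h'.2.1 k).trans_lt (h0 ▸ hpos)
      · exact (h'.2.2 h0 k).trans_le (le_max_right _ _)

theorem exists_predictableTime_min (hu : UsualConditions 𝓕 P) (τ τ' : PredictableTime 𝓕 P) :
    ∃ θ : PredictableTime 𝓕 P, θ.time = fun ω => min (τ.time ω) (τ'.time ω) := by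
  obtain ⟨σ, hσ, hf⟩ := τ.foretold
  obtain ⟨σ', hσ', hf'⟩ := τ'.foretold
  refine hu.exists_predictableTime_of_tendsto (X := fun k ω => min (σ k ω) (σ' k ω))
    (fun k => (hσ k).min (hσ' k)) ?_ ?_
  · filter_upwards [hf, hf'] with ω h h' using h.2.1.min h'.2.1
  · filter_upwards [hf, hf'] with ω h h' hpos
    rw [lt_min_iff] at hpos
    exact Eventually.of_forall fun k => min_lt_min (h.2.2 hpos.1 k) (h'.2.2 hpos.2 k)

/-- The random time `τ + c`, truncated at the level `b`. -/
def addTrunc (τ : Ω → TimeSet T) (c : ℝ≥0) (b : TimeSet T) (ω : Ω) : TimeSet T :=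
  ⟨min ((τ ω : ℝ≥0) + c) b, Set.mem_Iic.2 ((min_le_right _ _).trans b.2)⟩

theorem IsStopping.addTrunc {τ : Ω → TimeSet T} (h : IsStopping 𝓕 τ) (c : ℝ≥0) (b : TimeSet T) :
    IsStopping 𝓕 (addTrunc τ c b) := isStopping_iff.2 fun t => by
  have e : {ω | PredictableStopping.addTrunc τ c b ω ≤ t} =
      {ω | (τ ω : ℝ≥0) + c ≤ t} ∪ {_ω | b ≤ t} := by
    ext ω
    simp [PredictableStopping.addTrunc, ← Subtype.coe_le_coe]
  rw [e]
  refine MeasurableSet.union ?_ (MeasurableSet.const (b ≤ t))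
  by_cases hct : c ≤ t
  · have e : {ω | (τ ω : ℝ≥0) + c ≤ t} =
        {ω | τ ω ≤ (⟨t - c, Set.mem_Iic.2 (tsub_le_self.trans t.2)⟩ : TimeSet T)} := by
      ext ω
      simp [← Subtype.coe_le_coe, le_tsub_iff_right hct]
    rw [e]
    exact 𝓕.mono (Subtype.coe_le_coe.1 tsub_le_self) _ (h.measurableSet_le _)
  · have e : {ω | (τ ω : ℝ≥0) + c ≤ t} = ∅ := by
      ext ω
      simp only [Set.mem_ofPred_eq, Set.mem_empty_iff_false, iff_false]
      exact fun hω => hct (le_add_self.trans hω)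
    rw [e]
    exact @MeasurableSet.empty _ (𝓕 t)

/-- A stopping time is turned into a predictable time by adding a positive constant and truncating
at `T`: it is foretold by adding smaller constants and truncating earlier. -/
theorem exists_predictableTime_add (hu : UsualConditions 𝓕 P) (hT : 0 < T) {τ : Ω → TimeSet T}
    (h : IsStopping 𝓕 τ) {c : ℝ≥0} (hc : 0 < c) :
    ∃ θ : PredictableTime 𝓕 P, θ.time = addTrunc τ c ⊤ := by
  obtain ⟨v, -, hv, hvc⟩ := exists_seq_strictMono_tendsto' hc
  have hbt : (⊥ : TimeSet T) < ⊤ := Subtype.coe_lt_coe.1 hT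
  obtain ⟨w, -, hw, hwT⟩ := exists_seq_strictMono_tendsto' hbt
  refine hu.exists_predictableTime_of_tendsto (X := fun k => addTrunc τ (v k) (w k))
    (fun k => h.addTrunc _ _) ?_ ?_
  · refine Eventually.of_forall fun ω => tendsto_subtype_rng.2 ?_
    exact ((tendsto_const_nhds (x := (τ ω : ℝ≥0))).add hvc).min
      ((continuous_subtype_val.tendsto _).comp hwT)
  · refine Eventually.of_forall fun ω _ => Eventually.of_forall fun k => ?_
    rw [← Subtype.coe_lt_coe]
    exact min_lt_min (add_lt_add_right (hv k).2 _) (hw k).2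

end Times

/-! ### The σ-algebras at a predictable time -/

section Sigma

variable {Ω : Type*} {m0 : MeasurableSpace Ω} {T : ℝ≥0} {𝓕 : Filtration (TimeSet T) m0}
  {P : Measure Ω}

theorem PredictableTime.bot_le_past (τ : PredictableTime 𝓕 P) : 𝓕 ⊥ ≤ τ.past :=
  fun _ hA => MeasurableSpace.measurableSet_generateFrom (Or.inl hA)

theorem PredictableTime.measurableSet_past_inter_lt (τ : PredictableTime 𝓕 P) {t : TimeSet T}
    {A : Set Ω} (hA : MeasurableSet[𝓕 t] A) : MeasurableSet[τ.past] (A ∩ {ω | t < τ.time ω}) :=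
  MeasurableSpace.measurableSet_generateFrom (Or.inr ⟨t, A, hA, rfl⟩)

theorem PredictableTime.past_le_of {τ : PredictableTime 𝓕 P} {m : MeasurableSpace Ω}
    (h0 : 𝓕 ⊥ ≤ m) (h : ∀ (t : TimeSet T) (A : Set Ω), MeasurableSet[𝓕 t] A →
      MeasurableSet[m] (A ∩ {ω | t < τ.time ω})) : τ.past ≤ m := by
  refine MeasurableSpace.generateFrom_le ?_
  rintro B (hB | ⟨t, A, hA, rfl⟩)
  · exact h0 _ hB
  · exact h t A hA

theorem UsualConditions.past_mono (hu : UsualConditions 𝓕 P) {τ τ' : PredictableTime 𝓕 P}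
    (h : After τ τ') : τ.past ≤ τ'.past := by
  refine PredictableTime.past_le_of τ'.bot_le_past fun t A hA => ?_
  refine hu.measurableSet_congr τ'.bot_le_past
    (τ'.measurableSet_past_inter_lt (hA.inter (τ.isStopping.measurableSet_gt t))) ?_
  filter_upwards [h] with ω hω
  simp only [Set.mem_inter_iff, Set.mem_ofPred_eq]
  exact ⟨fun h => h.1, fun h => ⟨h, h.2.trans_le hω⟩⟩

theorem measurableSet_stopping_iff {τ : Ω → TimeSet T} (hτ : IsStopping 𝓕 τ) {A : Set Ω} :
    MeasurableSet[IsStoppingTime.measurableSpace hτ] A ↔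
      ∀ t, MeasurableSet[𝓕 t] (A ∩ {ω | τ ω ≤ t}) := by
  refine (IsStoppingTime.measurableSet hτ A).trans ?_
  simp only [WithTop.coe_le_coe]
  refine ⟨fun h => h.2, fun h => ⟨?_, h⟩⟩
  refine le_iSup (fun t => (𝓕 t : MeasurableSpace Ω)) ⊤ _ ?_
  simpa using h ⊤

theorem measurableSet_stopping_inter_lt {τ : Ω → TimeSet T} (hτ : IsStopping 𝓕 τ) {t : TimeSet T}
    {A : Set Ω} (hA : MeasurableSet[𝓕 t] A) :
    MeasurableSet[IsStoppingTime.measurableSpace hτ] (A ∩ {ω | t < τ ω}) := by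
  refine (measurableSet_stopping_iff hτ).2 fun u => ?_
  rcases le_total t u with htu | htu
  · exact (𝓕.mono htu _ (hA.inter (hτ.measurableSet_gt t))).inter (hτ.measurableSet_le u)
  · convert @MeasurableSet.empty _ (𝓕 u) using 1
    ext ω
    simp only [Set.mem_inter_iff, Set.mem_ofPred_eq, Set.mem_empty_iff_false, iff_false]
    rintro ⟨⟨-, h1⟩, h2⟩
    exact absurd h1 (not_lt.2 (h2.trans htu))

theorem bot_le_measurableSpace_stopping {τ : Ω → TimeSet T} (hτ : IsStopping 𝓕 τ) :
    𝓕 ⊥ ≤ IsStoppingTime.measurableSpace hτ := fun _ hA =>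
  (measurableSet_stopping_iff hτ).2 fun t =>
    (𝓕.mono bot_le _ hA).inter (hτ.measurableSet_le t)

theorem PredictableTime.past_le_sigma (τ : PredictableTime 𝓕 P) : τ.past ≤ τ.sigma :=
  PredictableTime.past_le_of (bot_le_measurableSpace_stopping τ.isStopping) fun _ _ hA =>
    measurableSet_stopping_inter_lt τ.isStopping hA

theorem PredictableTime.sigma_le (τ : PredictableTime 𝓕 P) : τ.sigma ≤ m0 :=
  IsStoppingTime.measurableSpace_le τ.isStopping

theorem UsualConditions.measurableSpace_stopping_mono (hu : UsualConditions 𝓕 P)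
    {τ τ' : Ω → TimeSet T} (hτ : IsStopping 𝓕 τ) (hτ' : IsStopping 𝓕 τ')
    (h : ∀ᵐ ω ∂P, τ ω ≤ τ' ω) :
    IsStoppingTime.measurableSpace hτ ≤ IsStoppingTime.measurableSpace hτ' := fun A hA => by
  rw [measurableSet_stopping_iff] at hA ⊢
  intro t
  refine hu.measurableSet_congr (𝓕.mono bot_le) ((hA t).inter (hτ'.measurableSet_le t)) ?_
  filter_upwards [h] with ω hω
  simp only [Set.mem_inter_iff, Set.mem_ofPred_eq]
  exact ⟨fun h => ⟨h.1.1, h.2⟩, fun h => ⟨⟨h.1, hω.trans h.2⟩, h.2⟩⟩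

/-- The events strictly prior to the limit of an increasing sequence of random times are
generated by the events strictly prior to its members. -/
theorem UsualConditions.past_le_iSup (hu : UsualConditions 𝓕 P) {S : PredictableTime 𝓕 P}
    {σ : ℕ → Ω → TimeSet T} (hσ : Foretells P σ S.time) {G : ℕ → MeasurableSpace Ω}
    (hG0 : ∀ n, 𝓕 ⊥ ≤ G n) (hG : ∀ n (t : TimeSet T) (A : Set Ω), MeasurableSet[𝓕 t] A →
      MeasurableSet[G n] (A ∩ {ω | t < σ n ω})) : S.past ≤ ⨆ n, G n := by
  have h0 : 𝓕 ⊥ ≤ ⨆ n, G n := (hG0 0).trans (le_iSup G 0)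
  refine PredictableTime.past_le_of h0 fun t A hA => ?_
  refine hu.measurableSet_congr h0
    (MeasurableSet.iUnion fun n => le_iSup G n _ (hG n t A hA)) ?_
  filter_upwards [hσ] with ω hω
  simp only [Set.mem_iUnion, Set.mem_inter_iff, Set.mem_ofPred_eq]
  refine ⟨fun ⟨n, h1, h2⟩ => ⟨h1, h2.trans_le (hω.1.ge_of_tendsto hω.2.1 n)⟩, fun ⟨h1, h2⟩ => ?_⟩
  obtain ⟨n, hn⟩ := (hω.2.1.eventually_const_lt h2).exists
  exact ⟨n, h1, hn⟩

/-- For `A ∈ 𝓕_σ`, the event `A ∩ {σ < τ}` is strictly prior to `τ`. -/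
theorem PredictableTime.measurableSet_past_inter_stopping_lt (τ : PredictableTime 𝓕 P)
    {σ : Ω → TimeSet T} {A : Set Ω} (hA : ∀ t, MeasurableSet[𝓕 t] (A ∩ {ω | σ ω ≤ t})) :
    MeasurableSet[τ.past] (A ∩ {ω | σ ω < τ.time ω}) := by
  obtain ⟨D, hDc, hDd⟩ := TopologicalSpace.exists_countable_dense (TimeSet T)
  have e : A ∩ {ω | σ ω < τ.time ω} =
      ⋃ q ∈ D, ((A ∩ {ω | σ ω ≤ q}) ∩ {ω | q < τ.time ω}) := by
    ext ω
    simp only [Set.mem_inter_iff, Set.mem_ofPred_eq, Set.mem_iUnion, exists_prop]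
    constructor
    · rintro ⟨h1, h2⟩
      obtain ⟨q, hq, h3, h4⟩ := hDd.exists_between h2
      exact ⟨q, hq, ⟨h1, h3.le⟩, h4⟩
    · rintro ⟨q, hq, ⟨h1, h2⟩, h3⟩
      exact ⟨h1, h2.trans_lt h3⟩
  rw [e]
  exact MeasurableSet.biUnion hDc fun q _ => τ.measurableSet_past_inter_lt (hA q)

theorem PredictableTime.measurableSet_past_stopping_lt (τ : PredictableTime 𝓕 P)
    {σ : Ω → TimeSet T} (hσ : IsStopping 𝓕 σ) : MeasurableSet[τ.past] {ω | σ ω < τ.time ω} := by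
  simpa using τ.measurableSet_past_inter_stopping_lt (A := Set.univ) (σ := σ)
    (by simpa using isStopping_iff.1 hσ)

/-- Predictability of `τ'` makes the event `{τ' ≤ τ}`, and not only `{τ' < τ}`, strictly prior
to `τ`. -/
theorem UsualConditions.measurableSet_past_le (hu : UsualConditions 𝓕 P)
    (τ τ' : PredictableTime 𝓕 P) : MeasurableSet[τ.past] {ω | τ'.time ω ≤ τ.time ω} := by
  obtain ⟨σ, hσ, hf⟩ := τ'.foretold
  have h1 : MeasurableSet[τ.past] {ω | τ'.time ω ≤ ⊥} :=
    τ.bot_le_past _ (τ'.isStopping.measurableSet_le ⊥)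
  refine hu.measurableSet_congr τ.bot_le_past (h1.union
    (MeasurableSet.iInter fun n => τ.measurableSet_past_stopping_lt (hσ n))) ?_
  filter_upwards [hf] with ω hω
  simp only [Set.mem_union, Set.mem_iInter, Set.mem_ofPred_eq]
  constructor
  · rintro (h | h)
    · exact h.trans bot_le
    · exact le_of_tendsto' hω.2.1 fun n => (h n).le
  · intro h
    rcases eq_or_lt_of_le (bot_le : ⊥ ≤ τ'.time ω) with h0 | h0
    · exact Or.inl h0.ge
    · exact Or.inr fun n => (hω.2.2 h0 n).trans_le h

theorem UsualConditions.measurableSet_past_eq (hu : UsualConditions 𝓕 P)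
    (τ τ' : PredictableTime 𝓕 P) : MeasurableSet[τ.past] {ω | τ.time ω = τ'.time ω} := by
  have h := (hu.measurableSet_past_le τ τ').diff (τ.measurableSet_past_stopping_lt τ'.isStopping)
  convert h using 1
  ext ω
  simp only [Set.mem_ofPred_eq, Set.mem_sdiff, not_lt]
  exact ⟨fun h => ⟨h.ge, h.le⟩, fun h => le_antisymm h.2 h.1⟩

/-- On the event that two predictable times agree, their strict pasts agree. -/
theorem UsualConditions.measurableSet_past_inter_eq (hu : UsualConditions 𝓕 P)
    (τ τ' : PredictableTime 𝓕 P) {B : Set Ω} (hB : MeasurableSet[τ.past] B) :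
    MeasurableSet[τ'.past] (B ∩ {ω | τ.time ω = τ'.time ω}) := by
  have hE : MeasurableSet[τ'.past] {ω | τ.time ω = τ'.time ω} := by
    simpa only [eq_comm] using hu.measurableSet_past_eq τ' τ
  induction B, hB using MeasurableSpace.generateFrom_induction with
  | hC B hB _ =>
    rcases hB with hB | ⟨t, A, hA, rfl⟩
    · exact (τ'.bot_le_past _ hB).inter hE
    · convert (τ'.measurableSet_past_inter_lt hA).inter hE using 1
      ext ω
      simp only [Set.mem_inter_iff, Set.mem_ofPred_eq]
      exact ⟨fun ⟨⟨h1, h2⟩, h3⟩ => ⟨⟨h1, h3 ▸ h2⟩, h3⟩, fun ⟨⟨h1, h2⟩, h3⟩ => ⟨⟨h1, h3 ▸ h2⟩, h3⟩⟩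
  | empty => simp
  | compl B _ ih =>
    convert hE.diff ih using 1
    ext ω
    simp only [Set.mem_inter_iff, Set.mem_compl_iff, Set.mem_sdiff]
    tauto
  | iUnion f _ ih =>
    rw [Set.iUnion_inter]
    exact MeasurableSet.iUnion ih

/-- Right continuity of the filtration, along random times: `⋂ₙ 𝓕_{Sₙ} ⊆ 𝓕_S` if `Sₙ → S` from
the right. -/
theorem UsualConditions.measurableSet_sigma_of_tendsto (hu : UsualConditions 𝓕 P)
    {S : PredictableTime 𝓕 P} {s : ℕ → PredictableTime 𝓕 P}
    (hlim : ∀ᵐ ω ∂P, Tendsto (fun n => (s n).time ω) atTop (𝓝 (S.time ω))) {A : Set Ω}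
    (hA : ∀ n, MeasurableSet[(s n).sigma] A) : MeasurableSet[S.sigma] A := by
  refine (measurableSet_stopping_iff S.isStopping).2 fun t => ?_
  have hA' := fun n => (measurableSet_stopping_iff (s n).isStopping).1 (hA n)
  rcases eq_or_lt_of_le (le_top : t ≤ ⊤) with rfl | ht
  · simpa using hA' 0 ⊤
  refine hu.measurableSet_of_forall_gt ht fun q hq => ?_
  refine hu.measurableSet_congr (𝓕.mono bot_le) ((MeasurableSet.iUnion fun n => hA' n q).inter
    (𝓕.mono hq.le _ (S.isStopping.measurableSet_le t))) ?_
  filter_upwards [hlim] with ω hω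
  simp only [Set.mem_inter_iff, Set.mem_iUnion, Set.mem_ofPred_eq]
  refine ⟨fun ⟨⟨n, h1, _⟩, h2⟩ => ⟨h1, h2⟩, fun ⟨h1, h2⟩ => ⟨?_, h2⟩⟩
  obtain ⟨n, hn⟩ := (hω.eventually_lt_const (h2.trans_lt hq)).exists
  exact ⟨n, h1, hn.le⟩

/-! ### Pasting predictable times -/

open Classical in
/-- Two predictable times after `S` can be pasted along an event `A` strictly prior to `S`. If
`σ` foretells `S`, then `A` is the almost sure limit of the events `Aₙ = {E[1_A | 𝓕_{σₙ}] > 1/2}`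
by Lévy's upward theorem, and deciding at time `σₙ` according to `Aₙ` approaches the pasted time
from below. -/
theorem UsualConditions.exists_predictableTime_paste [IsFiniteMeasure P]
    (hu : UsualConditions 𝓕 P) {S θ θ' : PredictableTime 𝓕 P} (hθ : After S θ) (hθ' : After S θ')
    {A : Set Ω} (hA : MeasurableSet[S.past] A) :
    ∃ η : PredictableTime 𝓕 P,
      η.time = fun ω => if ω ∈ A then θ.time ω else θ'.time ω := by
  obtain ⟨σ, hσ, hf⟩ := S.foretold
  obtain ⟨ρ, hρ, hfρ⟩ := θ.foretold
  obtain ⟨ρ', hρ', hfρ'⟩ := θ'.foretold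
  let G : ℕ → MeasurableSpace Ω := fun n => IsStoppingTime.measurableSpace (hσ n)
  have hG : ∀ n, G n ≤ m0 := fun n => IsStoppingTime.measurableSpace_le (hσ n)
  have hGmono : Monotone G := fun a b hab =>
    hu.measurableSpace_stopping_mono _ _ (hf.mono fun ω hω => hω.1 hab)
  have hSG : S.past ≤ ⨆ n, G n := hu.past_le_iSup hf
    (fun n => bot_le_measurableSpace_stopping (hσ n))
    (fun n _ _ hC => measurableSet_stopping_inter_lt (hσ n) hC)
  have hX : Measurable[⨆ n, G n] (A.indicator (1 : Ω → ℝ≥0∞)) :=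
    (@measurable_const _ _ _ (⨆ n, G n) 1).indicator (hSG _ hA)
  have hlevy := tendsto_condLExp (P := P) hG hGmono hX (by
      rw [lintegral_indicator_one (S.past_le _ hA)]
      finiteness)
  let An : ℕ → Set Ω := fun n => {ω | 2⁻¹ < condLExp (G n) P (A.indicator 1) ω}
  have hAn : ∀ n, MeasurableSet[G n] (An n) := fun n =>
    measurableSet_lt measurable_const (measurable_condLExp (G n) P _)
  have hev : ∀ᵐ ω ∂P, ∀ᶠ n in atTop, (ω ∈ An n ↔ ω ∈ A) := by
    filter_upwards [hlevy] with ω hω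
    by_cases hωA : ω ∈ A
    · simp only [Set.indicator_of_mem hωA, Pi.one_apply] at hω
      filter_upwards [hω.eventually_const_lt (by simp : (2⁻¹ : ℝ≥0∞) < 1)] with n hn
      exact ⟨fun _ => hωA, fun _ => hn⟩
    · simp only [Set.indicator_of_notMem hωA] at hω
      filter_upwards [hω.eventually_lt_const (by simp : (0 : ℝ≥0∞) < 2⁻¹)] with n hn
      exact ⟨fun h => absurd h (not_lt.2 hn.le), fun h => absurd h hωA⟩
  refine hu.exists_predictableTime_of_tendsto
    (X := fun n ω => if ω ∈ An n then max (σ n ω) (ρ n ω) else max (σ n ω) (ρ' n ω))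
    (fun n => isStopping_iff.2 fun t => ?_) ?_ ?_
  · have h1 := ((measurableSet_stopping_iff (hσ n)).1 (hAn n) t).inter
      ((hρ n).measurableSet_le t)
    have h2 := ((measurableSet_stopping_iff (hσ n)).1 (hAn n).compl t).inter
      ((hρ' n).measurableSet_le t)
    convert h1.union h2 using 1
    ext ω
    simp only [Set.mem_ofPred_eq, Set.mem_union, Set.mem_inter_iff, Set.mem_compl_iff]
    by_cases h : ω ∈ An n <;> simp [h]
  · filter_upwards [hev, hf, hfρ, hfρ', hθ, hθ'] with ω h1 h2 h3 h4 h5 h6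
    by_cases hωA : ω ∈ A
    · simp only [hωA, if_true]
      have := h2.2.1.max h3.2.1
      rw [max_eq_right h5] at this
      refine this.congr' (h1.mono fun n hn => ?_)
      simp [hn, hωA]
    · simp only [hωA, if_false]
      have := h2.2.1.max h4.2.1
      rw [max_eq_right h6] at this
      refine this.congr' (h1.mono fun n hn => ?_)
      simp [hn, hωA]
  · filter_upwards [hev, hf, hfρ, hfρ', hθ, hθ'] with ω h1 h2 h3 h4 h5 h6 hpos
    have hlt : ∀ t, S.time ω ≤ t → ⊥ < t → ∀ n, σ n ω < t := fun t hSt ht n => by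
      rcases eq_or_lt_of_le (bot_le : ⊥ ≤ S.time ω) with h0 | h0
      · exact (h2.1.ge_of_tendsto h2.2.1 n).trans_lt (h0 ▸ ht)
      · exact (h2.2.2 h0 n).trans_le hSt
    by_cases hωA : ω ∈ A
    · simp only [hωA, if_true] at hpos ⊢
      filter_upwards [h1] with n hn
      simp only [hn, hωA, if_true]
      exact max_lt (hlt _ h5 hpos n) (h3.2.2 hpos n)
    · simp only [hωA, if_false] at hpos ⊢
      filter_upwards [h1] with n hn
      simp only [hn, hωA, if_false]
      exact max_lt (hlt _ h6 hpos n) (h4.2.2 hpos n)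

/-! ### Foretelling by predictable times -/

/-- An infimum is attained if it lies strictly below a bound that almost all terms respect. -/
theorem exists_eq_infTime {X : ℕ → Ω → TimeSet T} {ω : Ω} {c : TimeSet T}
    (hc : infTime X ω < c) (h : ∀ᶠ k in atTop, c ≤ X k ω) : ∃ k, X k ω = infTime X ω := by
  obtain ⟨N, hN⟩ := eventually_atTop.1 h
  obtain ⟨j, hj⟩ := infTime_lt_iff.1 hc
  have hjN : j < N := by
    by_contra! hjN
    exact (hN j hjN).not_gt hj
  obtain ⟨k, -, hk⟩ := Finset.exists_min_image (Finset.range N) (fun k => X k ω)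
    ⟨j, Finset.mem_range.2 hjN⟩
  refine ⟨k, le_antisymm (le_infTime fun i => ?_) (infTime_le X k ω)⟩
  rcases lt_or_ge i N with hi | hi
  · exact hk i (Finset.mem_range.2 hi)
  · exact ((hk j (Finset.mem_range.2 hjN)).trans hj.le).trans (hN i hi)

theorem le_addTrunc (τ : Ω → TimeSet T) (c : ℝ≥0) (ω : Ω) : τ ω ≤ addTrunc τ c ⊤ ω :=
  Subtype.coe_le_coe.1 (le_min le_self_add (τ ω).2)

theorem addTrunc_le (τ : Ω → TimeSet T) (c : ℝ≥0) (b : TimeSet T) (ω : Ω) :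
    (addTrunc τ c b ω : ℝ≥0) ≤ τ ω + c := min_le_left _ _

/-- If `Rₖ + εₖ` is eventually below the limit `S` of the stopping times `Rₖ < S`, then the
infimum of the `Rₖ + εₖ` is attained, and it is therefore foretold by the infima of `Rₖ + w εₖ`
as `w ↑ 1`. -/
theorem UsualConditions.exists_predictableTime_infTime (hu : UsualConditions 𝓕 P)
    {S : Ω → TimeSet T} {R : ℕ → Ω → TimeSet T} (hR : ∀ k, IsStopping 𝓕 (R k))
    (hlim : ∀ᵐ ω ∂P, Tendsto (fun k => R k ω) atTop (𝓝 (S ω))) {ε : ℕ → ℝ≥0}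
    (hε : ∀ k, 0 < ε k) (hε1 : ∀ k, ε k ≤ 1)
    (hlt : ∀ᵐ ω ∂P, infTime (fun k => addTrunc (R k) (ε k) ⊤) ω < S ω) :
    ∃ τ : PredictableTime 𝓕 P, τ.time = infTime fun k => addTrunc (R k) (ε k) ⊤ := by
  obtain ⟨w, -, hw, hw1⟩ := exists_seq_strictMono_tendsto' (zero_lt_one : (0 : ℝ≥0) < 1)
  refine hu.exists_predictableTime_of_tendsto
    (X := fun p => infTime fun k => addTrunc (R k) (w p * ε k) ⊤)
    (fun p => hu.isStopping_infTime fun k => (hR k).addTrunc _ _) ?_ ?_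
  · refine Eventually.of_forall fun ω => tendsto_subtype_rng.2 ?_
    have hlow : ∀ p, ((infTime (fun k => addTrunc (R k) (ε k) ⊤) ω : TimeSet T) : ℝ≥0) - (1 - w p)
        ≤ (infTime (fun k => addTrunc (R k) (w p * ε k) ⊤) ω : TimeSet T) := fun p => by
      refine le_ciInf fun k => tsub_le_iff_right.2 ?_
      refine (Subtype.coe_le_coe.2 (infTime_le _ k ω)).trans ?_
      have hk : w p * ε k + (1 - w p) ≥ ε k := by
        calc ε k = (w p + (1 - w p)) * ε k := by rw [add_tsub_cancel_of_le (hw p).2.le, one_mul]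
          _ = w p * ε k + (1 - w p) * ε k := add_mul _ _ _
          _ ≤ w p * ε k + (1 - w p) * 1 := by gcongr; exact hε1 k
          _ = _ := by rw [mul_one]
      change min ((R k ω : ℝ≥0) + ε k) T ≤ min ((R k ω : ℝ≥0) + w p * ε k) T + (1 - w p)
      rw [← min_add_add_right, add_assoc]
      exact min_le_min (by gcongr) le_self_add
    have hup : ∀ p, ((infTime (fun k => addTrunc (R k) (w p * ε k) ⊤) ω : TimeSet T) : ℝ≥0)
        ≤ (infTime (fun k => addTrunc (R k) (ε k) ⊤) ω : TimeSet T) := fun p => by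
      refine Subtype.coe_le_coe.2 (le_infTime fun k => (infTime_le _ k ω).trans ?_)
      refine Subtype.coe_le_coe.1 (min_le_min (add_le_add_right ?_ _) le_rfl)
      exact mul_le_of_le_one_left' (hw p).2.le
    refine tendsto_of_tendsto_of_tendsto_of_le_of_le ?_ tendsto_const_nhds hlow hup
    have h1 : Tendsto (fun p => 1 - w p) atTop (𝓝 (1 - 1)) := tendsto_const_nhds.sub hw1
    have h2 := (tendsto_const_nhds (x :=
      ((infTime (fun k => addTrunc (R k) (ε k) ⊤) ω : TimeSet T) : ℝ≥0))).sub h1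
    simpa using h2
  · filter_upwards [hlim, hlt] with ω h1 h2 _
    obtain ⟨c, hc1, hc2⟩ := exists_between h2
    obtain ⟨k, hk⟩ := exists_eq_infTime hc1 (by
      filter_upwards [h1.eventually_const_lt hc2] with k hk
      exact hk.le.trans (le_addTrunc _ _ _))
    refine Eventually.of_forall fun p => infTime_lt_iff.2 ⟨k, ?_⟩
    rw [← hk]
    -- the infimum lies below `S ≤ T`, so the truncation at `T` is not active at its minimizer
    have hT : addTrunc (R k) (ε k) ⊤ ω < ⊤ := by
      rw [hk]
      exact h2.trans_le le_top
    have e : (R k ω : ℝ≥0) + ε k < T := by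
      by_contra! hcon
      exact hT.ne (Subtype.ext (min_eq_right hcon))
    have e2 : w p * ε k < ε k := mul_lt_of_lt_one_left (hε k) (hw p).2
    refine Subtype.coe_lt_coe.1 ?_
    change min ((R k ω : ℝ≥0) + w p * ε k) T < min ((R k ω : ℝ≥0) + ε k) T
    rw [min_eq_left e.le]
    exact (min_le_left _ _).trans_lt (add_lt_add_right e2 _)

/-- Every predictable time is foretold by predictable times: if `Rₖ` foretells `S`, choose
`εₖ → 0` so small that `Rₖ + εₖ < S` eventually (Borel–Cantelli), and take
`inf_{k ≥ n} (Rₖ + εₖ)`. Triviality of `𝓕 0` separates the case `S = 0` from the case `S > 0`. -/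
theorem UsualConditions.exists_foretells [IsProbabilityMeasure P] (hu : UsualConditions 𝓕 P)
    (htriv : ∀ A : Set Ω, MeasurableSet[𝓕 ⊥] A → P A = 0 ∨ P A = 1)
    (S : PredictableTime 𝓕 P) :
    ∃ s : ℕ → PredictableTime 𝓕 P, Foretells P (fun n => (s n).time) S.time := by
  rcases htriv _ (S.isStopping.measurableSet_le ⊥) with h0 | h0
  swap
  · obtain ⟨z, hz⟩ := exists_predictableTime_const (𝓕 := 𝓕) (P := P) hu ⊥
    refine ⟨fun _ => z, ?_⟩
    have h1 : ∀ᵐ ω ∂P, S.time ω ≤ ⊥ :=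
      (mem_ae_iff_prob_eq_one (𝓕.le _ _ (S.isStopping.measurableSet_le ⊥))).2 h0
    filter_upwards [h1] with ω hω
    have : S.time ω = ⊥ := le_bot_iff.1 hω
    simp only [hz, this]
    exact ⟨monotone_const, tendsto_const_nhds, fun h => absurd h (lt_irrefl _)⟩
  have hpos : ∀ᵐ ω ∂P, ⊥ < S.time ω := by
    filter_upwards [measure_eq_zero_iff_ae_notMem.1 h0] with ω hω using not_le.1 hω
  obtain ⟨R, hR, hf⟩ := S.foretold
  have hSm : Measurable S.time :=
    measurable_of_Iic fun t => 𝓕.le _ _ (S.isStopping.measurableSet_le t)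
  have hRm : ∀ k, Measurable (R k) := fun k =>
    measurable_of_Iic fun t => 𝓕.le _ _ ((hR k).measurableSet_le t)
  obtain ⟨v, hvanti, hv, hv0⟩ := exists_seq_strictAnti_tendsto' (zero_lt_one : (0 : ℝ≥0) < 1)
  have hchoose : ∀ k : ℕ, ∃ e : ℝ≥0, 0 < e ∧ e ≤ v k ∧
      P {ω | (S.time ω : ℝ≥0) ≤ R k ω + e} ≤ (2⁻¹ : ℝ≥0∞) ^ k := fun k => by
    have hanti : Antitone fun j => {ω | (S.time ω : ℝ≥0) ≤ R k ω + v j} := fun a b hab ω hω =>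
      le_trans hω (add_le_add_right (hvanti.antitone hab) _)
    have hlim := tendsto_measure_iInter_atTop (μ := P)
      (s := fun j => {ω | (S.time ω : ℝ≥0) ≤ R k ω + v j})
      (fun j => (measurableSet_le hSm.subtype_val
        ((hRm k).subtype_val.add_const _)).nullMeasurableSet) hanti ⟨0, by finiteness⟩
    have hz : P (⋂ j, {ω | (S.time ω : ℝ≥0) ≤ R k ω + v j}) = 0 := by
      refine measure_eq_zero_iff_ae_notMem.2 ?_
      filter_upwards [hpos, hf] with ω h1 h2 hmem
      simp only [Set.mem_iInter, Set.mem_ofPred_eq] at hmem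
      have hle : (S.time ω : ℝ≥0) ≤ R k ω + 0 :=
        ge_of_tendsto' (tendsto_const_nhds.add hv0) hmem
      rw [add_zero] at hle
      exact (h2.2.2 h1 k).not_ge hle
    rw [hz] at hlim
    have hpow : (0 : ℝ≥0∞) < 2⁻¹ ^ k := ENNReal.pow_pos (by simp) k
    obtain ⟨j, hj, hjk⟩ := ((hlim.eventually_lt_const hpow).and (eventually_ge_atTop k)).exists
    exact ⟨v j, (hv j).1, hvanti.antitone hjk, hj.le⟩
  choose ε hε hεv hεP using hchoose
  have hε1 : ∀ k, ε k ≤ 1 := fun k => (hεv k).trans (hv k).2.le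
  have hBC : ∀ᵐ ω ∂P, ∀ᶠ k in atTop, (R k ω : ℝ≥0) + ε k < S.time ω := by
    have hsum : ∑' k, P {ω | (S.time ω : ℝ≥0) ≤ R k ω + ε k} ≠ ∞ := by
      refine ne_top_of_le_ne_top ?_ (ENNReal.tsum_le_tsum hεP)
      rw [ENNReal.tsum_geometric]
      simp
    filter_upwards [ae_eventually_notMem hsum] with ω hω
    exact hω.mono fun k hk => not_le.1 hk
  have hlt : ∀ᵐ ω ∂P, ∀ n,
      infTime (fun k => addTrunc (R (n + k)) (ε (n + k)) ⊤) ω < S.time ω := by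
    filter_upwards [hBC] with ω hω n
    obtain ⟨k, hk, hnk⟩ := (hω.and (eventually_ge_atTop n)).exists
    refine infTime_lt_iff.2 ⟨k - n, ?_⟩
    rw [Nat.add_sub_cancel' hnk]
    exact Subtype.coe_lt_coe.1 ((addTrunc_le _ _ _ _).trans_lt hk)
  have hD := fun n => hu.exists_predictableTime_infTime (fun k => hR (n + k))
    (S := S.time) (ε := fun k => ε (n + k)) (by
      filter_upwards [hf] with ω hω
      simpa only [add_comm n] using (tendsto_add_atTop_iff_nat n).2 hω.2.1)
    (fun k => hε _) (fun k => hε1 _) (hlt.mono fun ω hω => hω n)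
  choose s hs using hD
  refine ⟨s, ?_⟩
  filter_upwards [hf, hlt] with ω h1 h2
  simp only [hs]
  refine ⟨monotone_infTime_tail (fun k => addTrunc (R k) (ε k) ⊤) ω,
    tendsto_infTime_tail (X := fun k => addTrunc (R k) (ε k) ⊤) ?_, fun _ => h2⟩
  have hε0 : Tendsto ε atTop (𝓝 0) :=
    tendsto_of_tendsto_of_tendsto_of_le_of_le tendsto_const_nhds hv0 (fun k => zero_le) hεv
  have hR' : Tendsto (fun k => (R k ω : ℝ≥0)) atTop (𝓝 (S.time ω : ℝ≥0)) :=
    (continuous_subtype_val.tendsto _).comp h1.2.1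
  refine tendsto_subtype_rng.2 (tendsto_of_tendsto_of_tendsto_of_le_of_le hR'
    (by simpa using hR'.add hε0) (fun k => Subtype.coe_le_coe.2 (le_addTrunc _ _ _))
    fun k => addTrunc_le _ _ _ _)

end Sigma

/-! ### Conditional expectations on a common trace -/

section Trace

variable {Ω : Type*} {m0 : MeasurableSpace Ω}

theorem measurable_indicator_of_trace {m m' : MeasurableSpace Ω} {A : Set Ω}
    (hA : MeasurableSet[m] A) (h : ∀ B, MeasurableSet[m'] B → MeasurableSet[m] (B ∩ A))
    {f : Ω → ℝ≥0∞} (hf : Measurable[m'] f) : Measurable[m] (A.indicator f) := by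
  intro s hs
  have h1 : MeasurableSet[m] (f ⁻¹' s ∩ A) := h _ (hf hs)
  by_cases h0 : (0 : ℝ≥0∞) ∈ s
  · convert h1.union hA.compl using 1
    ext ω
    by_cases hω : ω ∈ A <;> simp [hω, h0]
  · convert h1 using 1
    ext ω
    by_cases hω : ω ∈ A <;> simp [hω, h0]

/-- Conditional expectations are local: if two σ-algebras have the same trace on a common event
`A`, and two random variables agree on `A`, then so do their conditional expectations. -/
theorem condLExp_ae_eq_of_trace {P : Measure Ω} [IsFiniteMeasure P] {m m' : MeasurableSpace Ω}
    (hm : m ≤ m0) (hm' : m' ≤ m0) {A : Set Ω} (hA : MeasurableSet[m] A)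
    (h : ∀ B, MeasurableSet[m] B → MeasurableSet[m'] (B ∩ A))
    (h' : ∀ B, MeasurableSet[m'] B → MeasurableSet[m] (B ∩ A)) {X Y : Ω → ℝ≥0∞}
    (hXY : ∀ᵐ ω ∂P, ω ∈ A → X ω = Y ω) :
    ∀ᵐ ω ∂P, ω ∈ A → condLExp m P X ω = condLExp m' P Y ω := by
  have key : A.indicator (condLExp m P X) =ᵐ[P] A.indicator (condLExp m' P Y) := by
    refine ae_eq_of_setLIntegral_eq hm ((measurable_condLExp m P X).indicator hA)
      (measurable_indicator_of_trace hA h' (measurable_condLExp m' P Y)) fun B hB => ?_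
    rw [setLIntegral_indicator (hm _ hA), setLIntegral_indicator (hm _ hA), Set.inter_comm A B,
      setLIntegral_condLExp hm P X (hB.inter hA), setLIntegral_condLExp hm' P Y (h B hB)]
    refine setLIntegral_congr_fun_ae (hm _ (hB.inter hA)) ?_
    filter_upwards [hXY] with ω hω hmem using hω hmem.2
  filter_upwards [key] with ω hω hmem
  simpa [hmem] using hω

end Trace

/-! ### The value family -/

section Value

variable {Ω : Type*} {m0 : MeasurableSpace Ω} {T : ℝ≥0} {𝓕 : Filtration (TimeSet T) m0}
  {P : Measure Ω} {φ : Family 𝓕 P}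

theorem IsAdmissible.measurable' (hφ : IsAdmissible φ) (τ : PredictableTime 𝓕 P) :
    Measurable (φ τ) := (hφ.measurable τ).mono τ.past_le le_rfl

theorem After.trans {S τ θ : PredictableTime 𝓕 P} (h : After S τ) (h' : After τ θ) :
    After S θ := by
  filter_upwards [h, h'] with ω h1 h2 using h1.trans h2

theorem After.refl (S : PredictableTime 𝓕 P) : After S S := Eventually.of_forall fun _ => le_rfl

theorem measurable_condPast (S : PredictableTime 𝓕 P) (X : Ω → ℝ≥0∞) :
    Measurable (condPast S X) := measurable_condLExp' S.past P X

variable [IsFiniteMeasure P]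

theorem value_spec (φ : Family 𝓕 P) (S : PredictableTime 𝓕 P) :
    IsEssSup S.past P (fun τ : {τ : PredictableTime 𝓕 P // After S τ} => condPast S (φ τ))
      (value φ S) := essSupFamily_spec _ _ _ _

theorem strictValue_spec (φ : Family 𝓕 P) (S : PredictableTime 𝓕 P) :
    IsEssSup S.past P
      (fun τ : {τ : PredictableTime 𝓕 P // StrictlyAfter S τ} => condPast S (φ τ))
      (strictValue φ S) := essSupFamily_spec _ _ _ _

theorem measurable_value (φ : Family 𝓕 P) (S : PredictableTime 𝓕 P) : Measurable (value φ S) :=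
  (value_spec φ S).measurable.mono S.past_le le_rfl

theorem condPast_le_value (φ : Family 𝓕 P) {S τ : PredictableTime 𝓕 P} (h : After S τ) :
    condPast S (φ τ) ≤ᵐ[P] value φ S := (value_spec φ S).le ⟨τ, h⟩

theorem IsAdmissible.le_value (hφ : IsAdmissible φ) (S : PredictableTime 𝓕 P) :
    φ S ≤ᵐ[P] value φ S := by
  have h := condPast_le_value φ (After.refl S)
  rwa [condPast, condLExp_eq_self S.past_le P (hφ.measurable S)] at h

theorem condPast_ae_eq_of_eq_on {S : PredictableTime 𝓕 P} {A : Set Ω}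
    (hA : MeasurableSet[S.past] A) {X Y : Ω → ℝ≥0∞} (hXY : ∀ᵐ ω ∂P, ω ∈ A → X ω = Y ω) :
    ∀ᵐ ω ∂P, ω ∈ A → condPast S X ω = condPast S Y ω :=
  condLExp_ae_eq_of_trace S.past_le S.past_le hA (fun _ hB => hB.inter hA)
    (fun _ hB => hB.inter hA) hXY

/-- The family of conditional expected rewards defining the value is upward directed, by pasting
two predictable times along the event where one of them is the better choice. -/
theorem IsAdmissible.directed (hφ : IsAdmissible φ) (hu : UsualConditions 𝓕 P)
    (S : PredictableTime 𝓕 P) (θ θ' : {τ : PredictableTime 𝓕 P // After S τ}) :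
    ∃ η : {τ : PredictableTime 𝓕 P // After S τ},
      condPast S (φ θ) ≤ᵐ[P] condPast S (φ η) ∧ condPast S (φ θ') ≤ᵐ[P] condPast S (φ η) := by
  classical
  have hA : MeasurableSet[S.past] {ω | condPast S (φ θ') ω ≤ condPast S (φ θ) ω} :=
    measurableSet_le (measurable_condLExp _ _ _) (measurable_condLExp _ _ _)
  obtain ⟨η, hη⟩ := hu.exists_predictableTime_paste θ.2 θ'.2 hA
  have hSη : After S η := by
    filter_upwards [θ.2, θ'.2] with ω h1 h2
    rw [hη]
    dsimp only
    split_ifs <;> assumption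
  have e1 := condPast_ae_eq_of_eq_on (P := P) hA (X := φ θ) (Y := φ η) (by
    filter_upwards [hφ.congr θ η] with ω hω hmem
    refine hω ?_
    rw [hη]
    exact (if_pos hmem).symm)
  have e2 := condPast_ae_eq_of_eq_on (P := P) hA.compl (X := φ θ') (Y := φ η) (by
    filter_upwards [hφ.congr θ' η] with ω hω hmem
    refine hω ?_
    rw [hη]
    exact (if_neg hmem).symm)
  refine ⟨⟨η, hSη⟩, ?_, ?_⟩
  all_goals
    filter_upwards [e1, e2] with ω h1 h2
    by_cases hω : condPast S (φ θ') ω ≤ condPast S (φ θ) ω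
    · have := h1 hω
      order
    · have := h2 hω
      have := not_le.1 hω
      order

theorem IsAdmissible.exists_seq_value (hφ : IsAdmissible φ) (hu : UsualConditions 𝓕 P)
    (htail : UniformTail P φ) (S : PredictableTime 𝓕 P) :
    ∃ u : ℕ → PredictableTime 𝓕 P, (∀ n, After S (u n)) ∧
      (∀ᵐ ω ∂P, Monotone fun n => condPast S (φ (u n)) ω) ∧
      ∀ᵐ ω ∂P, value φ S ω = ⨆ n, condPast S (φ (u n)) ω := by
  obtain ⟨K, hK, hKφ⟩ := htail.exists_lintegral_le
  have : Nonempty {τ : PredictableTime 𝓕 P // After S τ} := ⟨⟨S, After.refl S⟩⟩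
  obtain ⟨u, hu1, hu2⟩ := (value_spec φ S).exists_seq S.past_le
    (fun τ => measurable_condLExp S.past P (φ τ)) (hφ.directed hu S) hK
    (fun τ => (lintegral_condLExp S.past_le P (φ τ)).trans_le (hKφ _))
  refine ⟨fun n => (u n).1, fun n => (u n).2, ?_, hu2⟩
  filter_upwards [ae_all_iff.2 hu1] with ω hω using monotone_nat_of_le_succ hω

/-- The value family is a supermartingale system. -/
theorem IsAdmissible.setLIntegral_value_le (hφ : IsAdmissible φ) (hu : UsualConditions 𝓕 P)
    (htail : UniformTail P φ) {S τ : PredictableTime 𝓕 P} (h : After S τ) {A : Set Ω}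
    (hA : MeasurableSet[S.past] A) :
    ∫⁻ ω in A, value φ τ ω ∂P ≤ ∫⁻ ω in A, value φ S ω ∂P := by
  obtain ⟨u, hu1, hu2, hu3⟩ := hφ.exists_seq_value hu htail τ
  have hA' : MeasurableSet[τ.past] A := hu.past_mono h _ hA
  rw [lintegral_congr_ae (ae_restrict_of_ae hu3), lintegral_iSup'
    (fun n => (measurable_condPast τ (φ (u n))).aemeasurable) (ae_restrict_of_ae hu2)]
  refine iSup_le fun n => ?_
  calc ∫⁻ ω in A, condPast τ (φ (u n)) ω ∂P = ∫⁻ ω in A, φ (u n) ω ∂P :=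
        setLIntegral_condLExp τ.past_le P _ hA'
    _ = ∫⁻ ω in A, condPast S (φ (u n)) ω ∂P := (setLIntegral_condLExp S.past_le P _ hA).symm
    _ ≤ _ := lintegral_mono_ae (ae_restrict_of_ae (condPast_le_value φ (h.trans (hu1 n))))

/-- The value family inherits uniform integrability from the reward family. -/
theorem IsAdmissible.uniformTail_value (hφ : IsAdmissible φ) (hu : UsualConditions 𝓕 P)
    (htail : UniformTail P φ) : UniformTail P (value φ) := by
  intro ε hε
  obtain ⟨C, hC⟩ := htail ε hε
  refine ⟨C, fun S => ?_⟩
  obtain ⟨u, hu1, hu2, hu3⟩ := hφ.exists_seq_value hu htail S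
  have e : ∀ᵐ ω ∂P, value φ S ω - C = ⨆ n, (condPast S (φ (u n)) ω - C) := by
    filter_upwards [hu3] with ω hω
    rw [hω, ENNReal.iSup_sub]
  rw [lintegral_congr_ae e, lintegral_iSup'
    (f := fun n ω => condPast S (φ (u n)) ω - C)
    (fun n => ((measurable_condPast S (φ (u n))).sub measurable_const).aemeasurable)
    (hu2.mono fun ω hω a b hab => tsub_le_tsub_right (hω hab) _)]
  exact iSup_le fun n => (lintegral_condLExp_tsub_le S.past_le _ C).trans (hC (u n))

theorem IsAdmissible.value_le_of_eq (hφ : IsAdmissible φ) (hu : UsualConditions 𝓕 P)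
    (τ τ' : PredictableTime 𝓕 P) :
    ∀ᵐ ω ∂P, τ.time ω = τ'.time ω → value φ τ ω ≤ value φ τ' ω := by
  classical
  have hE := hu.measurableSet_past_eq τ τ'
  have hle : value φ τ ≤ᵐ[P]
      fun ω => if τ.time ω = τ'.time ω then value φ τ' ω else ∞ := by
    refine (value_spec φ τ).least _
      ((measurable_value φ τ').ite (τ.past_le _ hE) measurable_const) fun θ => ?_
    -- replacing `θ` by `θ ∨ τ'` changes nothing where `τ = τ'`
    obtain ⟨η, hη⟩ := exists_predictableTime_max hu θ.1 τ'
    have hη' : After τ' η := Eventually.of_forall fun ω => by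
      rw [hη]
      exact le_max_right _ _
    have heq := condLExp_ae_eq_of_trace (P := P) τ.past_le τ'.past_le hE (X := φ θ.1) (Y := φ η)
      (fun B hB => hu.measurableSet_past_inter_eq τ τ' hB)
      (fun B hB => by simpa only [eq_comm] using hu.measurableSet_past_inter_eq τ' τ hB) (by
        filter_upwards [hφ.congr θ.1 η, θ.2] with ω h1 h2 hmem
        refine h1 ?_
        rw [hη]
        exact (max_eq_left (hmem.symm.trans_le h2)).symm)
    filter_upwards [heq, condPast_le_value φ hη'] with ω h1 h2
    split_ifs with h
    · exact (h1 h).trans_le h2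
    · exact le_top
  filter_upwards [hle] with ω hω h
  simpa [h] using hω

/-- The value family is admissible. -/
theorem IsAdmissible.value_congr (hφ : IsAdmissible φ) (hu : UsualConditions 𝓕 P)
    (τ τ' : PredictableTime 𝓕 P) :
    ∀ᵐ ω ∂P, τ.time ω = τ'.time ω → value φ τ ω = value φ τ' ω := by
  filter_upwards [hφ.value_le_of_eq hu τ τ', hφ.value_le_of_eq hu τ' τ] with ω h1 h2 h
  exact le_antisymm (h1 h) (h2 h.symm)

end Value

section Limits

variable {Ω : Type*} {m0 : MeasurableSpace Ω} {T : ℝ≥0} {𝓕 : Filtration (TimeSet T) m0}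
  {P : Measure Ω} {φ : Family 𝓕 P}

/-! ### Monotone sequences of predictable times -/

theorem StrictlyAfter.after {S τ : PredictableTime 𝓕 P} (h : StrictlyAfter S τ) : After S τ := by
  filter_upwards [h] with ω hω
  rcases eq_or_lt_of_le (le_top : S.time ω ≤ ⊤) with h0 | h0
  · rw [hω.2 h0]
    exact le_top
  · exact (hω.1 h0).le

theorem StrictlyAfter.min {S τ τ' θ : PredictableTime 𝓕 P} (h : StrictlyAfter S τ)
    (h' : StrictlyAfter S τ') (hθ : θ.time = fun ω => min (τ.time ω) (τ'.time ω)) :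
    StrictlyAfter S θ := by
  filter_upwards [h, h'] with ω h1 h2
  rw [hθ]
  exact ⟨fun h => lt_min (h1.1 h) (h2.1 h), fun h => by simp [h1.2 h, h2.2 h]⟩

theorem DecreasesTo.antitone_past (hu : UsualConditions 𝓕 P) {S : PredictableTime 𝓕 P}
    {s : ℕ → PredictableTime 𝓕 P} (hd : DecreasesTo s S) : Antitone fun n => (s n).past :=
  fun _ _ hab => hu.past_mono (hd.mono fun _ hω => hω.1 hab)

theorem UsualConditions.exists_decreasesTo (hu : UsualConditions 𝓕 P) (hT : 0 < T)
    (S : PredictableTime 𝓕 P) :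
    ∃ s : ℕ → PredictableTime 𝓕 P, (∀ n, StrictlyAfter S (s n)) ∧ DecreasesTo s S := by
  obtain ⟨v, hvanti, hv, hv0⟩ := exists_seq_strictAnti_tendsto' (zero_lt_one : (0 : ℝ≥0) < 1)
  choose s hs using fun n => exists_predictableTime_add (P := P) hu hT S.isStopping (hv n).1
  refine ⟨s, fun n => Eventually.of_forall fun ω => ?_, Eventually.of_forall fun ω => ?_⟩
  · rw [hs]
    refine ⟨fun h => Subtype.coe_lt_coe.1 (lt_min (lt_add_of_pos_right _ (hv n).1) h),
      fun h => top_le_iff.1 (h.symm.le.trans (le_addTrunc _ _ _))⟩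
  · simp only [hs]
    refine ⟨fun a b hab => Subtype.coe_le_coe.1
      (min_le_min (add_le_add_right (hvanti.antitone hab) _) le_rfl), tendsto_subtype_rng.2 ?_⟩
    have h := ((tendsto_const_nhds (x := (S.time ω : ℝ≥0))).add hv0).min
      (tendsto_const_nhds (x := T))
    rw [add_zero, min_eq_left (S.time ω).2] at h
    exact h

theorem PredictableTime.measurableSet_sigma_lt_top (S : PredictableTime 𝓕 P) :
    MeasurableSet[S.sigma] {ω | S.time ω < ⊤} := by
  refine (measurableSet_stopping_iff S.isStopping).2 fun t => ?_
  rcases eq_or_lt_of_le (le_top : t ≤ ⊤) with rfl | ht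
  · exact (S.isStopping.measurableSet_lt ⊤).inter (S.isStopping.measurableSet_le ⊤)
  · convert S.isStopping.measurableSet_le t using 1
    ext ω
    simp only [Set.mem_inter_iff, Set.mem_ofPred_eq, and_iff_right_iff_imp]
    exact fun h => h.trans_lt ht

theorem Foretells.after {S : PredictableTime 𝓕 P} {s : ℕ → PredictableTime 𝓕 P}
    (hf : Foretells P (fun n => (s n).time) S.time) (n : ℕ) : After (s n) S :=
  hf.mono fun _ hω => hω.1.ge_of_tendsto hω.2.1 n

theorem Foretells.monotone_past (hu : UsualConditions 𝓕 P) {S : PredictableTime 𝓕 P}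
    {s : ℕ → PredictableTime 𝓕 P} (hf : Foretells P (fun n => (s n).time) S.time) :
    Monotone fun n => (s n).past :=
  fun _ _ hab => hu.past_mono (hf.mono fun _ hω => hω.1 hab)

variable [IsFiniteMeasure P]

/-! ### Right limits of the value family -/

theorem IsAdmissible.exists_tendsto_of_decreasesTo (hφ : IsAdmissible φ)
    (hu : UsualConditions 𝓕 P) (htail : UniformTail P φ) {S : PredictableTime 𝓕 P}
    {s : ℕ → PredictableTime 𝓕 P} (hd : DecreasesTo s S) :
    ∀ᵐ ω ∂P, ∃ c, Tendsto (fun n => value φ (s n) ω) atTop (𝓝 c) := by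
  obtain ⟨K, hK, hKV⟩ := (hφ.uniformTail_value hu htail).exists_lintegral_le
  exact exists_tendsto_of_backward_supermartingale (fun n => (s n).past_le) (hd.antitone_past hu)
    (fun n => (value_spec φ (s n)).measurable) (fun n => ne_top_of_le_ne_top hK (hKV _))
    fun n A hA => hφ.setLIntegral_value_le hu htail (hd.mono fun ω hω => hω.1 n.le_succ) hA

/-- The upper limit depends only on the tail of the sequence, so it is measurable with respect to
every `𝓕_{sₙ}`, and hence with respect to `𝓕_S` by right continuity. -/
theorem measurable_limsup_of_decreasesTo (hu : UsualConditions 𝓕 P) {S : PredictableTime 𝓕 P}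
    {s : ℕ → PredictableTime 𝓕 P} (hd : DecreasesTo s S) :
    Measurable[S.sigma] fun ω => limsup (fun n => value φ (s n) ω) atTop := by
  have h : ∀ N, Measurable[(s N).sigma] fun ω => limsup (fun n => value φ (s n) ω) atTop := by
    intro N
    have e : (fun ω => limsup (fun n => value φ (s n) ω) atTop) =
        fun ω => limsup (fun n => value φ (s (n + N)) ω) atTop :=
      funext fun ω => (limsup_nat_add (fun n => value φ (s n) ω) N).symm
    rw [e]
    exact Measurable.limsup fun n => (value_spec φ (s (n + N))).measurable.mono
      ((hd.antitone_past hu (Nat.le_add_left N n)).trans (s N).past_le_sigma) le_rfl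
  exact fun B hB => hu.measurableSet_sigma_of_tendsto (hd.mono fun ω hω => hω.2)
    fun N => h N hB

/-- A right limit at `S` dominates the value at every later predictable time `τ`, on average over
the events that are strictly prior to all predictable times after `S`: compare with the value at
`τ ∧ sₙ`, which is eventually the value at `sₙ`. -/
theorem IsAdmissible.setLIntegral_value_le_of_tendsto (hφ : IsAdmissible φ)
    (hu : UsualConditions 𝓕 P) (htail : UniformTail P φ) {S : PredictableTime 𝓕 P}
    {s : ℕ → PredictableTime 𝓕 P} (hs : ∀ n, StrictlyAfter S (s n)) (hd : DecreasesTo s S)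
    {R : Ω → ℝ≥0∞} (hR : ∀ᵐ ω ∂P, Tendsto (fun n => value φ (s n) ω) atTop (𝓝 (R ω)))
    {τ : PredictableTime 𝓕 P} (hτ : StrictlyAfter S τ) {A : Set Ω}
    (hA : ∀ η : PredictableTime 𝓕 P, StrictlyAfter S η → MeasurableSet[η.past] A) :
    ∫⁻ ω in A, value φ τ ω ∂P ≤ ∫⁻ ω in A, R ω ∂P := by
  choose η hη using fun n => exists_predictableTime_min hu τ (s n)
  have hlim : ∀ᵐ ω ∂P, Tendsto (fun n => value φ (η n) ω) atTop (𝓝 (R ω)) := by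
    filter_upwards [hR, hd, hτ, ae_all_iff.2 hs,
      ae_all_iff.2 fun n => hφ.value_congr hu (η n) (s n)] with ω h1 h2 h3 h4 h5
    refine h1.congr' ?_
    rcases eq_or_lt_of_le (le_top : S.time ω ≤ ⊤) with h0 | h0
    · refine Eventually.of_forall fun n => (h5 n ?_).symm
      simp [hη, h3.2 h0, (h4 n).2 h0]
    · filter_upwards [h2.2.eventually_lt_const (h3.1 h0)] with n hn
      refine (h5 n ?_).symm
      rw [hη]
      exact min_eq_right hn.le
  refine ge_of_tendsto' (((hφ.uniformTail_value hu htail).comp η).tendsto_setLIntegral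
    (fun n => measurable_value φ _) hlim A) fun n => ?_
  refine hφ.setLIntegral_value_le hu htail (Eventually.of_forall fun ω => ?_)
    (hA _ (hτ.min (hs n) (hη n)))
  rw [hη]
  exact min_le_left _ _

/-- Comparison of the limits along two sequences decreasing to `S`. On `{S < T}` the events of `𝓕_S`
are strictly prior to every later time, and integrals can be compared; on `{S = T}` they need not
be, but there both sequences are constantly equal to `T`. -/
theorem IsAdmissible.right_limit_le (hφ : IsAdmissible φ)
    (hu : UsualConditions 𝓕 P) (htail : UniformTail P φ) {S : PredictableTime 𝓕 P}
    {s s' : ℕ → PredictableTime 𝓕 P} (hs : ∀ n, StrictlyAfter S (s n)) (hd : DecreasesTo s S)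
    (hs' : ∀ n, StrictlyAfter S (s' n)) {R R' : Ω → ℝ≥0∞}
    (hRm : Measurable[S.sigma] R) (hRm' : Measurable[S.sigma] R')
    (hR : ∀ᵐ ω ∂P, Tendsto (fun n => value φ (s n) ω) atTop (𝓝 (R ω)))
    (hR' : ∀ᵐ ω ∂P, Tendsto (fun n => value φ (s' n) ω) atTop (𝓝 (R' ω))) :
    R' ≤ᵐ[P] R := by
  have hE := S.measurableSet_sigma_lt_top
  have h1 : {ω | S.time ω < ⊤}.indicator R' ≤ᵐ[P] {ω | S.time ω < ⊤}.indicator R := by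
    refine ae_le_of_setLIntegral_le S.sigma_le (hRm'.indicator hE) (hRm.indicator hE)
      fun A hA => ?_
    rw [setLIntegral_indicator (S.sigma_le _ hE), setLIntegral_indicator (S.sigma_le _ hE)]
    refine le_of_tendsto' (((hφ.uniformTail_value hu htail).comp s').tendsto_setLIntegral
      (fun n => measurable_value φ _) hR' _) fun n => ?_
    refine hφ.setLIntegral_value_le_of_tendsto hu htail hs hd hR (hs' n) fun η hη => ?_
    -- an event of `𝓕_S` contained in `{S < T}` is, up to a null set, contained in `{S < η}`
    refine hu.measurableSet_congr η.bot_le_past (η.measurableSet_past_inter_stopping_lt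
      ((measurableSet_stopping_iff S.isStopping).1 (hE.inter hA))) ?_
    filter_upwards [hη] with ω hω
    exact ⟨fun h => h.1, fun h => ⟨h, hω.1 h.1⟩⟩
  filter_upwards [h1, hR, hR', ae_all_iff.2 hs, ae_all_iff.2 hs',
    ae_all_iff.2 fun n => hφ.value_congr hu (s n) (s' n)] with ω h1 h2 h3 h4 h5 h6
  rcases eq_or_lt_of_le (le_top : S.time ω ≤ ⊤) with h0 | h0
  · have h7 : Tendsto (fun n => value φ (s n) ω) atTop (𝓝 (R' ω)) :=
      h3.congr fun n => (h6 n (by rw [(h4 n).2 h0, (h5 n).2 h0])).symm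
    exact (tendsto_nhds_unique h7 h2).le
  · simpa [h0] using h1

theorem IsAdmissible.exists_isRightLimit (hφ : IsAdmissible φ) (hu : UsualConditions 𝓕 P)
    (hT : 0 < T) (htail : UniformTail P φ) (S : PredictableTime 𝓕 P) :
    ∃ R, IsRightLimit (value φ) S R := by
  have hlim : ∀ s : ℕ → PredictableTime 𝓕 P, DecreasesTo s S → ∀ᵐ ω ∂P,
      Tendsto (fun n => value φ (s n) ω) atTop
        (𝓝 (limsup (fun n => value φ (s n) ω) atTop)) := fun s hd => by
    filter_upwards [hφ.exists_tendsto_of_decreasesTo hu htail hd] with ω ⟨c, hc⟩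
    rwa [hc.limsup_eq]
  obtain ⟨s, hs, hd⟩ := hu.exists_decreasesTo hT S
  refine ⟨fun ω => limsup (fun n => value φ (s n) ω) atTop,
    measurable_limsup_of_decreasesTo hu hd, fun s' hs' hd' => ?_⟩
  have h1 := hφ.right_limit_le hu htail hs hd hs' (measurable_limsup_of_decreasesTo hu hd)
    (measurable_limsup_of_decreasesTo hu hd') (hlim s hd) (hlim s' hd')
  have h2 := hφ.right_limit_le hu htail hs' hd' hs (measurable_limsup_of_decreasesTo hu hd')
    (measurable_limsup_of_decreasesTo hu hd) (hlim s' hd') (hlim s hd)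
  filter_upwards [h1, h2, hlim s' hd'] with ω h1 h2 h3
  rwa [le_antisymm h2 h1]

/-! ### Left limits of the value family -/

theorem IsAdmissible.exists_tendsto_of_foretells (hφ : IsAdmissible φ)
    (hu : UsualConditions 𝓕 P) (htail : UniformTail P φ) {S : PredictableTime 𝓕 P}
    {s : ℕ → PredictableTime 𝓕 P} (hf : Foretells P (fun n => (s n).time) S.time) :
    ∀ᵐ ω ∂P, ∃ c, Tendsto (fun n => value φ (s n) ω) atTop (𝓝 c) := by
  obtain ⟨K, hK, hKV⟩ := (hφ.uniformTail_value hu htail).exists_lintegral_le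
  exact exists_tendsto_of_supermartingale (fun n => (s n).past_le) (hf.monotone_past hu)
    (fun n => (value_spec φ (s n)).measurable) (fun n => ne_top_of_le_ne_top hK (hKV _))
    fun n A hA => hφ.setLIntegral_value_le hu htail (hf.mono fun ω hω => hω.1 n.le_succ) hA

theorem measurable_limsup_of_foretells (hu : UsualConditions 𝓕 P) {S : PredictableTime 𝓕 P}
    {s : ℕ → PredictableTime 𝓕 P} (hf : Foretells P (fun n => (s n).time) S.time) :
    Measurable[S.past] fun ω => limsup (fun n => value φ (s n) ω) atTop :=
  Measurable.limsup fun n => (value_spec φ (s n)).measurable.mono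
    (hu.past_mono (hf.after n)) le_rfl

/-- By Lévy's upward theorem, an `𝓕_{S-}`-measurable random variable whose conditional
expectations are dominated by the values along a foretelling sequence is dominated by the left
limit. -/
theorem le_of_tendsto_of_foretells (hu : UsualConditions 𝓕 P) {S : PredictableTime 𝓕 P}
    {s : ℕ → PredictableTime 𝓕 P} (hf : Foretells P (fun n => (s n).time) S.time)
    {L Y : Ω → ℝ≥0∞} (hL : ∀ᵐ ω ∂P, Tendsto (fun n => value φ (s n) ω) atTop (𝓝 (L ω)))
    (hYm : Measurable[S.past] Y) (hY : ∫⁻ ω, Y ω ∂P ≠ ∞)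
    (h : ∀ n A, MeasurableSet[(s n).past] A →
      ∫⁻ ω in A, Y ω ∂P ≤ ∫⁻ ω in A, value φ (s n) ω ∂P) : Y ≤ᵐ[P] L := by
  have hle : ∀ n, condLExp (s n).past P Y ≤ᵐ[P] value φ (s n) := fun n =>
    condLExp_le_of_setLIntegral_le (s n).past_le (value_spec φ (s n)).measurable (h n)
  have hS : S.past ≤ ⨆ n, (s n).past := hu.past_le_iSup hf (fun n => (s n).bot_le_past)
    fun n _ _ hA => (s n).measurableSet_past_inter_lt hA
  filter_upwards [tendsto_condLExp (P := P) (fun n => (s n).past_le) (hf.monotone_past hu)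
    (hYm.mono hS le_rfl) hY, ae_all_iff.2 hle, hL] with ω h1 h2 h3
  exact le_of_tendsto_of_tendsto' h1 h3 h2

/-- Comparison of the limits along two foretelling sequences: `V(sₙ)` dominates the conditional
expectation given `𝓕_{sₙ-}` of `V(sₙ ∨ s'ₘ)`, and so that of its limit as `m → ∞`. -/
theorem IsAdmissible.left_limit_le (hφ : IsAdmissible φ) (hu : UsualConditions 𝓕 P)
    (htail : UniformTail P φ) {S : PredictableTime 𝓕 P} {s s' : ℕ → PredictableTime 𝓕 P}
    (hf : Foretells P (fun n => (s n).time) S.time)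
    (hf' : Foretells P (fun n => (s' n).time) S.time) {L L' : Ω → ℝ≥0∞}
    (hLm' : Measurable[S.past] L')
    (hL : ∀ᵐ ω ∂P, Tendsto (fun n => value φ (s n) ω) atTop (𝓝 (L ω)))
    (hL' : ∀ᵐ ω ∂P, Tendsto (fun n => value φ (s' n) ω) atTop (𝓝 (L' ω))) : L' ≤ᵐ[P] L := by
  have hVtail := hφ.uniformTail_value hu htail
  obtain ⟨K, hK, hKV⟩ := hVtail.exists_lintegral_le
  refine le_of_tendsto_of_foretells hu hf hL hLm' (ne_top_of_le_ne_top hK (le_of_tendsto'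
    ((hVtail.comp s').tendsto_lintegral (fun n => measurable_value φ _) hL') fun n => hKV _))
    fun n A hA => ?_
  -- replacing `s' m` by `s n ∨ s' m` does not change the limit in `m`
  choose η hη using fun m => exists_predictableTime_max hu (s n) (s' m)
  have hlim : ∀ᵐ ω ∂P, Tendsto (fun m => value φ (η m) ω) atTop (𝓝 (L' ω)) := by
    filter_upwards [hL', hf, hf', hf.after n,
      ae_all_iff.2 fun m => hφ.value_congr hu (η m) (s' m)] with ω h1 h2 h3 h4 h5
    refine h1.congr' ?_
    rcases eq_or_lt_of_le (bot_le : ⊥ ≤ S.time ω) with h0 | h0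
    · refine Eventually.of_forall fun m => (h5 m ?_).symm
      rw [hη]
      exact max_eq_right (h4.trans (h0.symm.le.trans bot_le))
    · filter_upwards [h3.2.1.eventually_const_lt (h2.2.2 h0 n)] with m hm
      refine (h5 m ?_).symm
      rw [hη]
      exact max_eq_right hm.le
  refine le_of_tendsto' ((hVtail.comp η).tendsto_setLIntegral
    (fun n => measurable_value φ _) hlim A) fun m => ?_
  refine hφ.setLIntegral_value_le hu htail (Eventually.of_forall fun ω => ?_) hA
  rw [hη]
  exact le_max_left _ _

theorem IsAdmissible.exists_isLeftLimit (hφ : IsAdmissible φ) (hu : UsualConditions 𝓕 P)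
    (htail : UniformTail P φ) {S : PredictableTime 𝓕 P} {s : ℕ → PredictableTime 𝓕 P}
    (hf : Foretells P (fun n => (s n).time) S.time) : ∃ L, IsLeftLimit (value φ) S L := by
  have hlim : ∀ s : ℕ → PredictableTime 𝓕 P, Foretells P (fun n => (s n).time) S.time → ∀ᵐ ω ∂P,
      Tendsto (fun n => value φ (s n) ω) atTop
        (𝓝 (limsup (fun n => value φ (s n) ω) atTop)) := fun s hf => by
    filter_upwards [hφ.exists_tendsto_of_foretells hu htail hf] with ω ⟨c, hc⟩
    rwa [hc.limsup_eq]
  refine ⟨fun ω => limsup (fun n => value φ (s n) ω) atTop,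
    measurable_limsup_of_foretells hu hf, fun s' hf' => ?_⟩
  filter_upwards [hlim s' hf', hφ.left_limit_le hu htail hf hf'
    (measurable_limsup_of_foretells hu hf') (hlim s hf) (hlim s' hf'),
    hφ.left_limit_le hu htail hf' hf
    (measurable_limsup_of_foretells hu hf) (hlim s' hf') (hlim s hf)] with ω h1 h2 h3
  rwa [le_antisymm h3 h2]

theorem IsAdmissible.value_le_of_isLeftLimit (hφ : IsAdmissible φ) (hu : UsualConditions 𝓕 P)
    (htail : UniformTail P φ) {S : PredictableTime 𝓕 P} {s : ℕ → PredictableTime 𝓕 P}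
    (hf : Foretells P (fun n => (s n).time) S.time) {L : Ω → ℝ≥0∞}
    (hL : IsLeftLimit (value φ) S L) : value φ S ≤ᵐ[P] L := by
  obtain ⟨K, hK, hKV⟩ := (hφ.uniformTail_value hu htail).exists_lintegral_le
  exact le_of_tendsto_of_foretells hu hf (hL.2 s hf) (value_spec φ S).measurable
    (ne_top_of_le_ne_top hK (hKV S))
    fun n A hA => hφ.setLIntegral_value_le hu htail (hf.after n) hA

/-! ### Comparison of the value with its right limit -/

theorem IsAdmissible.condPast_value_le (hφ : IsAdmissible φ) (hu : UsualConditions 𝓕 P)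
    (hT : 0 < T) (htail : UniformTail P φ) {S τ : PredictableTime 𝓕 P} {R : Ω → ℝ≥0∞}
    (hR : IsRightLimit (value φ) S R) (hτ : StrictlyAfter S τ) :
    condPast S (value φ τ) ≤ᵐ[P] condPast S R := by
  obtain ⟨s, hs, hd⟩ := hu.exists_decreasesTo hT S
  exact condLExp_le_condLExp_of_setLIntegral_le S.past_le fun A hA =>
    hφ.setLIntegral_value_le_of_tendsto hu htail hs hd (hR.2 s hs hd) hτ
      fun η hη => hu.past_mono hη.after _ hA

theorem IsAdmissible.strictValue_le (hφ : IsAdmissible φ) (hu : UsualConditions 𝓕 P)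
    (hT : 0 < T) (htail : UniformTail P φ) {S : PredictableTime 𝓕 P} {R : Ω → ℝ≥0∞}
    (hR : IsRightLimit (value φ) S R) : strictValue φ S ≤ᵐ[P] condPast S R :=
  (strictValue_spec φ S).least _ (measurable_condPast S R) fun τ =>
    (condLExp_mono (hφ.le_value τ.1)).trans (hφ.condPast_value_le hu hT htail hR τ.2)

theorem IsAdmissible.condPast_rightLimit_le (hφ : IsAdmissible φ) (hu : UsualConditions 𝓕 P)
    (hT : 0 < T) (htail : UniformTail P φ) {S : PredictableTime 𝓕 P} {R : Ω → ℝ≥0∞}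
    (hR : IsRightLimit (value φ) S R) : condPast S R ≤ᵐ[P] value φ S := by
  obtain ⟨s, hs, hd⟩ := hu.exists_decreasesTo hT S
  refine condLExp_le_of_setLIntegral_le S.past_le (value_spec φ S).measurable fun A hA => ?_
  exact le_of_tendsto' (((hφ.uniformTail_value hu htail).comp s).tendsto_setLIntegral
    (fun n => measurable_value φ _) (hR.2 s hs hd) A)
    fun n => hφ.setLIntegral_value_le hu htail (hs n).after hA

/-- A predictable time `θ ≥ S` either stops at `S`, on the event `{θ = S}` strictly prior to `S`,
or can be replaced by a time strictly after `S`. -/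
theorem IsAdmissible.value_le_max (hφ : IsAdmissible φ) (hu : UsualConditions 𝓕 P)
    (S : PredictableTime 𝓕 P) :
    ∀ᵐ ω ∂P, value φ S ω ≤ max (φ S ω) (strictValue φ S ω) := by
  classical
  refine (value_spec φ S).least _ ((hφ.measurable' S).max
    ((strictValue_spec φ S).measurable.mono S.past_le le_rfl)) fun θ => ?_
  have hE := hu.measurableSet_past_eq S θ.1
  obtain ⟨t, ht⟩ := exists_predictableTime_const (𝓕 := 𝓕) (P := P) hu ⊤
  have hSt : After S t := Eventually.of_forall fun ω => by simp [ht]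
  obtain ⟨η, hη⟩ := hu.exists_predictableTime_paste hSt θ.2 hE
  have hSη : StrictlyAfter S η := by
    filter_upwards [θ.2] with ω hω
    simp only [hη, ht, Set.mem_ofPred_eq]
    split_ifs with h
    · exact ⟨fun h => h, fun _ => rfl⟩
    · exact ⟨fun _ => lt_of_le_of_ne hω h, fun h' => top_le_iff.1 (h' ▸ hω)⟩
  have e1 := condPast_ae_eq_of_eq_on hE (X := φ θ.1) (Y := φ S) (by
    filter_upwards [hφ.congr θ.1 S] with ω hω h using hω h.symm)
  have e2 := condPast_ae_eq_of_eq_on hE.compl (X := φ θ.1) (Y := φ η) (by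
    filter_upwards [hφ.congr θ.1 η] with ω hω hmem
    refine hω ?_
    rw [hη]
    exact (if_neg hmem).symm)
  have e3 : condPast S (φ S) = φ S := condLExp_eq_self S.past_le P (hφ.measurable S)
  filter_upwards [e1, e2, (strictValue_spec φ S).le ⟨η, hSη⟩] with ω h1 h2 h3
  by_cases h : S.time ω = θ.1.time ω
  · exact le_max_of_le_left ((h1 h).trans (congrFun e3 ω)).le
  · exact le_max_of_le_right ((h2 h).trans_le h3)

theorem IsAdmissible.value_eq_max (hφ : IsAdmissible φ) (hu : UsualConditions 𝓕 P)
    (hT : 0 < T) (htail : UniformTail P φ) {S : PredictableTime 𝓕 P} {R : Ω → ℝ≥0∞}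
    (hR : IsRightLimit (value φ) S R) :
    ∀ᵐ ω ∂P, value φ S ω = max (φ S ω) (condPast S R ω) := by
  filter_upwards [hφ.value_le_max hu S, hφ.strictValue_le hu hT htail hR, hφ.le_value S,
    hφ.condPast_rightLimit_le hu hT htail hR] with ω h1 h2 h3 h4
  exact le_antisymm (h1.trans (max_le_max le_rfl h2)) (max_le h3 h4)

/-- Right continuity in expectation gives `V(S+)` and `V(S)` the same mean, which turns the
inequality between `E[V(S+) | 𝓕_{S-}]` and `V(S)` into an equality. -/
theorem IsAdmissible.condPast_rightLimit_eq_of_rcpe (hφ : IsAdmissible φ)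
    (hu : UsualConditions 𝓕 P) (hT : 0 < T) (htail : UniformTail P φ)
    (hrcpe : RCPE (value φ)) {S : PredictableTime 𝓕 P} {R : Ω → ℝ≥0∞}
    (hR : IsRightLimit (value φ) S R) : condPast S R =ᵐ[P] value φ S := by
  obtain ⟨K, hK, hKV⟩ := (hφ.uniformTail_value hu htail).exists_lintegral_le
  obtain ⟨s, hs, hd⟩ := hu.exists_decreasesTo hT S
  have hint : ∫⁻ ω, R ω ∂P = ∫⁻ ω, value φ S ω ∂P := tendsto_nhds_unique
    (((hφ.uniformTail_value hu htail).comp s).tendsto_lintegral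
      (fun n => measurable_value φ _) (hR.2 s hs hd)) (hrcpe S s hd)
  have hint' : ∫⁻ ω, condPast S R ω ∂P = ∫⁻ ω, R ω ∂P := lintegral_condLExp S.past_le P R
  refine ae_eq_of_ae_le_of_lintegral_le (hφ.condPast_rightLimit_le hu hT htail hR) ?_
    (measurable_value φ S).aemeasurable (by rw [hint', hint])
  rw [hint', hint]
  exact ne_top_of_le_ne_top hK (hKV S)

end Limits

end PredictableStopping

theorem mainTheorem6 {Ω : Type*} {m0 : MeasurableSpace Ω} (P : Measure Ω) [IsProbabilityMeasure P]
    (T : ℝ≥0) (hT : 0 < T)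
    (𝓕 : Filtration (PredictableStopping.TimeSet T) m0)
    (husual : PredictableStopping.UsualConditions 𝓕 P)
    (htriv : ∀ A : Set Ω, MeasurableSet[𝓕 ⊥] A → P A = 0 ∨ P A = 1)
    (φ : PredictableStopping.Family 𝓕 P)
    (hφ : PredictableStopping.IsAdmissible φ)
    (hUI : PredictableStopping.IsUniformlyIntegrable φ) :
    -- the one-sided limits of the value family exist
    (∀ S : PredictableStopping.PredictableTime 𝓕 P,
      (∃ R, PredictableStopping.IsRightLimit (PredictableStopping.value φ) S R) ∧
      (∃ L, PredictableStopping.IsLeftLimit (PredictableStopping.value φ) S L)) ∧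
    -- the inequalities and identities, for all versions `R` of `V_p(S+)` and `L` of `V_p(S-)`
    (∀ (S : PredictableStopping.PredictableTime 𝓕 P) (R L : Ω → ℝ≥0∞),
      PredictableStopping.IsRightLimit (PredictableStopping.value φ) S R →
      PredictableStopping.IsLeftLimit (PredictableStopping.value φ) S L →
      (∀ τ : PredictableStopping.PredictableTime 𝓕 P, (∀ᵐ ω ∂P, S.time ω < τ.time ω) →
        PredictableStopping.condPast S (PredictableStopping.value φ τ)
          ≤ᵐ[P] PredictableStopping.condPast S R) ∧
      PredictableStopping.strictValue φ S ≤ᵐ[P] PredictableStopping.condPast S R ∧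
      PredictableStopping.value φ S ≤ᵐ[P] L ∧
      PredictableStopping.condPast S R ≤ᵐ[P] PredictableStopping.value φ S ∧
      (∀ᵐ ω ∂P, PredictableStopping.value φ S ω
        = max (φ S ω) (PredictableStopping.condPast S R ω)) ∧
      (∀ᵐ ω ∂P, PredictableStopping.value φ S ω ≠ ∞ ∧ PredictableStopping.condPast S R ω ≠ ∞ ∧
        (PredictableStopping.value φ S ω).toReal - (PredictableStopping.condPast S R ω).toReal
          = Set.indicator {ω' | PredictableStopping.value φ S ω' = φ S ω'}
              (fun ω' => (PredictableStopping.value φ S ω').toReal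
                - (PredictableStopping.condPast S R ω').toReal) ω)) ∧
    -- equality under right continuity in expectation
    (PredictableStopping.RCPE (PredictableStopping.value φ) →
      ∀ (S : PredictableStopping.PredictableTime 𝓕 P) (R : Ω → ℝ≥0∞),
        PredictableStopping.IsRightLimit (PredictableStopping.value φ) S R →
        PredictableStopping.condPast S R =ᵐ[P] PredictableStopping.value φ S) := by
  have htail : PredictableStopping.UniformTail P φ :=
    PredictableStopping.uniformTail_of_uniformIntegrable hUI.1 hUI.2
  obtain ⟨K, hK, hKV⟩ := (hφ.uniformTail_value husual htail).exists_lintegral_le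
  have hfore := husual.exists_foretells htriv
  refine ⟨fun S => ?_, fun S R L hR hL => ?_, fun hrcpe S R hR =>
    hφ.condPast_rightLimit_eq_of_rcpe husual hT htail hrcpe hR⟩
  · obtain ⟨s, hs⟩ := hfore S
    exact ⟨hφ.exists_isRightLimit husual hT htail S, hφ.exists_isLeftLimit husual htail hs⟩
  obtain ⟨s, hs⟩ := hfore S
  have hle := hφ.condPast_rightLimit_le husual hT htail hR
  have hmax := hφ.value_eq_max husual hT htail hR
  refine ⟨fun τ hτ => hφ.condPast_value_le husual hT htail hR ?_,
    hφ.strictValue_le husual hT htail hR, hφ.value_le_of_isLeftLimit husual htail hs hL, hle,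
    hmax, ?_⟩
  · filter_upwards [hτ] with ω hω
    exact ⟨fun _ => hω, fun h => absurd (h ▸ hω) not_top_lt⟩
  · filter_upwards [hle, hmax, ae_lt_top (PredictableStopping.measurable_value φ S)
      (ne_top_of_le_ne_top hK (hKV S))] with ω h1 h2 h3
    refine ⟨h3.ne, (h1.trans_lt h3).ne, ?_⟩
    by_cases h : PredictableStopping.value φ S ω = φ S ω
    · rw [Set.indicator_of_mem (Set.mem_ofPred_eq.symm ▸ h)]
    · rw [Set.indicator_of_notMem (by simpa using h)]
      have h4 : PredictableStopping.value φ S ω = PredictableStopping.condPast S R ω := by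
        rcases le_total (φ S ω) (PredictableStopping.condPast S R ω) with h5 | h5
        · rw [h2, max_eq_right h5]
        · exact absurd (h2.trans (max_eq_left h5)) h
      rw [h4, sub_self]
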